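/- Conventions. Let $C=\{f=0\}\subset\mathbb{C}^2$ be a reduced affine plane curve ($f\in\mathbb{C}[x,y]$ squarefree), $U=\mathbb{C}^2\setminus C$ its complement, and $G=\pi_1(U,u_0)$ for a base point $u_0\in U$. The rational derived series of $G$ is $G_r^{(0)}=G$ and, for $n\ge 1$, $G_r^{(n)}=\{g\in G_r^{(n-1)} : g^k\in[G_r^{(n-1)},G_r^{(n-1)}]\text{ for some }k\in\mathbb{Z}\setminus\{0\}\}$. Put $\Gamma_n=G/G_r^{(n+1)}$. Let $\psi:G\to\mathbb{Z}$ be the linking number homomorphism $\alpha\mapsto \mathrm{lk}(\alpha,C)$ (the winding number of $f\circ\alpha$ around $0$), $\bar\psi:\Gamma_n\to\mathbb{Z}$ the homomorphism it induces, and $\bar\Gamma_n=\ker\bar\psi$. The group ring $\mathbb{Z}\bar\Gamma_n$ is an Ore domain; let $S_n=\mathbb{Z}\bar\Gamma_n\setminus\{0\}$, let $\mathbb{K}_n=(\mathbb{Z}\bar\Gamma_n)S_n^{-1}$ be its skew field of quotients, and let $R_n=(\mathbb{Z}\Gamma_n)S_n^{-1}$. The $n$-th order degree of $C$ is $$\delta_n(C)=\mathrm{rk}_{\mathbb{K}_n}H_1(U;R_n)\in\{0,1,2,\dots\}\cup\{\infty\},$$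 the rank over $\mathbb{K}_n$ of the first homology of $U$ with coefficients in the local system $R_n$ given by $G\to\Gamma_n\subset R_n$, viewed as a right $R_n$-module. Proposition. Let $m\ge 1$ and let $C\subset\mathbb{C}^2$ be a reduced curve that is the union of $m$ distinct, pairwise parallel complex lines $L_1,\dots,L_m$. Then, for all $n\ge 0$ (and every base point), $$\delta_n(C)=\begin{cases}\infty, & m>1,\\ 0, & m=1.\end{cases}$$ -/

import Mathlib

universe u
open scoped nonZeroDivisors commutatorElement

namespace HigherDegree

theorem coe_mem_commutator_iff {G : Type u} [Group G] (H : Subgroup G) (x : H) :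
    (x : G) ∈ ⁅H, H⁆ ↔ Abelianization.of x = 1 := by
  rw [← MonoidHom.mem_ker, Abelianization.ker_of, ← Subgroup.map_subtype_commutator]
  simp

/-- The subgroup of those elements of `H` a nonzero power of which lies in `[H, H]`. -/
def rationalStep {G : Type u} [Group G] (H : Subgroup G) : Subgroup G where
  carrier := {g | g ∈ H ∧ ∃ k : ℤ, k ≠ 0 ∧ g ^ k ∈ ⁅H, H⁆}
  one_mem' := ⟨H.one_mem, 1, one_ne_zero, by simp⟩
  mul_mem' := by
    rintro a b ⟨ha, k, hk, hak⟩ ⟨hb, l, hl, hbl⟩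
    refine ⟨H.mul_mem ha hb, k * l, mul_ne_zero hk hl, ?_⟩
    lift a to H using ha
    lift b to H using hb
    have h1 : Abelianization.of a ^ k = 1 := by
      rw [← map_zpow, ← coe_mem_commutator_iff]; exact_mod_cast hak
    have h2 : Abelianization.of b ^ l = 1 := by
      rw [← map_zpow, ← coe_mem_commutator_iff]; exact_mod_cast hbl
    have : Abelianization.of ((a * b) ^ (k * l)) = 1 := by
      rw [map_zpow, map_mul, mul_zpow, zpow_mul, h1, mul_comm k l, zpow_mul, h2]; simp
    exact_mod_cast (coe_mem_commutator_iff H _).2 this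
  inv_mem' := by
    rintro a ⟨ha, k, hk, hak⟩
    exact ⟨H.inv_mem ha, k, hk, by rw [inv_zpow]; exact Subgroup.inv_mem _ hak⟩

/-- The rational derived series `G_r^(n)` of a group `G`. -/
def rationalDerived (G : Type u) [Group G] : ℕ → Subgroup G
  | 0 => ⊤
  | n + 1 => rationalStep (rationalDerived G n)

theorem map_rationalStep_le {G G' : Type u} [Group G] [Group G'] (f : G →* G')
    (H : Subgroup G) : (rationalStep H).map f ≤ rationalStep (H.map f) := by
  rintro _ ⟨g, ⟨hg, k, hk, hgk⟩, rfl⟩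
  refine ⟨⟨g, hg, rfl⟩, k, hk, ?_⟩
  rw [← Subgroup.map_commutator, ← map_zpow]
  exact ⟨_, hgk, rfl⟩

theorem rationalStep_mono {G : Type u} [Group G] {H K : Subgroup G} (h : H ≤ K) :
    rationalStep H ≤ rationalStep K := by
  rintro g ⟨hg, k, hk, hgk⟩
  exact ⟨h hg, k, hk, Subgroup.commutator_mono h h hgk⟩

theorem map_rationalDerived_le {G G' : Type u} [Group G] [Group G'] (f : G →* G') (n : ℕ) :
    (rationalDerived G n).map f ≤ rationalDerived G' n := by
  induction n with
  | zero => exact le_top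
  | succ n ih => exact (map_rationalStep_le f _).trans (rationalStep_mono ih)

instance normal_rationalDerived (G : Type u) [Group G] (n : ℕ) : (rationalDerived G n).Normal where
  conj_mem x hx g := map_rationalDerived_le (MulAut.conj g).toMonoidHom n ⟨x, hx, rfl⟩

theorem rationalDerived_antitone (G : Type u) [Group G] (n : ℕ) :
    rationalDerived G (n + 1) ≤ rationalDerived G n := fun _ h => h.1

theorem map_subtype_rationalDerived_le (G : Type u) [Group G] (n : ℕ) :
    (rationalDerived (rationalDerived G 1) n).map (rationalDerived G 1).subtype
      ≤ rationalDerived G (n + 1) := by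
  induction n with
  | zero => rintro _ ⟨x, -, rfl⟩; exact x.2
  | succ n ih => exact (map_rationalStep_le _ _).trans (rationalStep_mono ih)

theorem rationalDerived_quotient (G : Type u) [Group G] (n : ℕ) :
    rationalDerived (G ⧸ rationalDerived G n) n = ⊥ := by
  have key : ∀ k ≤ n, rationalDerived (G ⧸ rationalDerived G n) k ≤
      (rationalDerived G k).map (QuotientGroup.mk' (rationalDerived G n)) := by
    intro k
    induction k with
    | zero =>
      intro _ x _
      obtain ⟨g, rfl⟩ := QuotientGroup.mk_surjective x
      exact ⟨g, trivial, rfl⟩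
    | succ k ih =>
      intro hk x hx
      obtain ⟨hx1, j, hj, hxj⟩ := rationalStep_mono (ih (by omega)) hx
      obtain ⟨g, hg, rfl⟩ := hx1
      rw [← Subgroup.map_commutator, ← map_zpow] at hxj
      obtain ⟨c, hc, hce⟩ := hxj
      have hmem : c⁻¹ * g ^ j ∈ rationalDerived G n := by
        rw [← QuotientGroup.eq]; exact hce
      have hanti : Antitone (rationalDerived G) := antitone_nat_of_succ_le (rationalDerived_antitone G)
      obtain ⟨-, i, hi, hci⟩ := hanti hk hmem
      refine ⟨g, ⟨hg, j * i, mul_ne_zero hj hi, ?_⟩, rfl⟩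
      set H := rationalDerived G k
      have hcH : c ∈ H := (Subgroup.commutator_le_self H) hc
      have h1 : Abelianization.of (⟨c, hcH⟩ : H) = 1 := (coe_mem_commutator_iff H _).1 hc
      have h2 : Abelianization.of ((⟨c, hcH⟩ : H)⁻¹ * (⟨g, hg⟩ : H) ^ j) ^ i = 1 := by
        rw [← map_zpow, ← coe_mem_commutator_iff]; simpa using hci
      have h3 : Abelianization.of ((⟨g, hg⟩ : H) ^ (j * i)) = 1 := by
        rw [zpow_mul, map_zpow]
        simpa [h1] using h2
      simpa using (coe_mem_commutator_iff H _).2 h3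
  rw [eq_bot_iff]
  refine (key n le_rfl).trans ?_
  rintro _ ⟨x, hx, rfl⟩
  simpa using hx

theorem rationalDerived_eq_bot_of_injective {G G' : Type u} [Group G] [Group G'] (f : G →* G')
    (hf : Function.Injective f) (n : ℕ) (h : rationalDerived G' n = ⊥) :
    rationalDerived G n = ⊥ := by
  rw [eq_bot_iff]
  intro x hx
  have := map_rationalDerived_le f n ⟨x, hx, rfl⟩
  rw [h, Subgroup.mem_bot] at this
  exact hf (this.trans (map_one f).symm)

theorem commutator_le_rationalDerived_one (G : Type u) [Group G] :
    commutator G ≤ rationalDerived G 1 := fun g hg =>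
  ⟨trivial, 1, one_ne_zero, by rw [zpow_one]; exact hg⟩

theorem mem_rationalDerived_one_of_pow (G : Type u) [Group G] (g : G) (n : ℕ) (hn : n ≠ 0)
    (h : g ^ n ∈ rationalDerived G 1) : g ∈ rationalDerived G 1 := by
  obtain ⟨-, k, hk, hgk⟩ := h
  exact ⟨trivial, n * k, mul_ne_zero (by exact_mod_cast hn) hk, by rw [zpow_mul]; simpa using hgk⟩

instance commGroupAb (G : Type u) [Group G] : CommGroup (G ⧸ rationalDerived G 1) where
  mul_comm := by
    intro a b
    obtain ⟨a, rfl⟩ := QuotientGroup.mk_surjective a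
    obtain ⟨b, rfl⟩ := QuotientGroup.mk_surjective b
    rw [← QuotientGroup.mk_mul, ← QuotientGroup.mk_mul, QuotientGroup.eq]
    apply commutator_le_rationalDerived_one
    have : (a * b)⁻¹ * (b * a) = ⁅b⁻¹, a⁻¹⁆ := by simp [commutatorElement_def, mul_assoc]
    rw [this]
    exact Subgroup.commutator_mem_commutator trivial trivial

instance torsionFreeAb (G : Type u) [Group G] : IsMulTorsionFree (G ⧸ rationalDerived G 1) where
  pow_left_injective := by
    intro n hn a b hab
    simp only at hab
    have : (a * b⁻¹) ^ n = 1 := by rw [mul_pow, hab, inv_pow, mul_inv_cancel]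
    have h2 : a * b⁻¹ = 1 := by
      generalize a * b⁻¹ = c at this
      obtain ⟨c, rfl⟩ := QuotientGroup.mk_surjective c
      rw [← QuotientGroup.mk_pow, QuotientGroup.eq_one_iff] at this
      rw [QuotientGroup.eq_one_iff]
      exact mem_rationalDerived_one_of_pow G c n hn this
    exact mul_inv_eq_one.1 h2

theorem uniqueProds_of_commGroup (A : Type u) [CommGroup A] [IsMulTorsionFree A] :
    UniqueProds A := by
  have : UniqueSums (Additive A) :=
    UniqueSums.of_injective_addHom (DivisibleHull.coeAddMonoidHom (M := Additive A)).toAddHom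
      DivisibleHull.coe_injective inferInstance
  constructor
  intro S T hS hT
  exact this.uniqueAdd_of_nonempty (A := S) (B := T) hS hT

theorem uniqueProds_of_extension {G A : Type u} [Group G] [Group A] (f : G →* A)
    (hA : UniqueProds A) (hN : UniqueProds f.ker) : UniqueProds G := by
  classical
  constructor
  intro S T hS hT
  obtain ⟨aH, haH, bH, hbH, hu⟩ := hA.uniqueMul_of_nonempty (hS.image f) (hT.image f)
  obtain ⟨a1, ha1, rfl⟩ := Finset.mem_image.1 haH
  obtain ⟨b1, hb1, rfl⟩ := Finset.mem_image.1 hbH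
  let S' : Finset f.ker := Finset.preimage S (fun x => a1 * x)
    (fun x _ y _ h => Subtype.ext (mul_left_cancel h))
  let T' : Finset f.ker := Finset.preimage T (fun x => x * b1)
    (fun x _ y _ h => Subtype.ext (mul_right_cancel h))
  have hS' : S'.Nonempty := ⟨1, Finset.mem_preimage.2 (by simpa using ha1)⟩
  have hT' : T'.Nonempty := ⟨1, Finset.mem_preimage.2 (by simpa using hb1)⟩
  obtain ⟨a, ha, b, hb, hab⟩ := hN.uniqueMul_of_nonempty hS' hT'
  have haS : a1 * (a : G) ∈ S := Finset.mem_preimage (f := fun x : f.ker => a1 * (x : G)) |>.1 ha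
  have hbT : (b : G) * b1 ∈ T := Finset.mem_preimage (f := fun x : f.ker => (x : G) * b1) |>.1 hb
  refine ⟨a1 * a, haS, b * b1, hbT, ?_⟩
  have hfa : f (a : G) = 1 := a.2
  have hfb : f (b : G) = 1 := b.2
  refine UniqueMul.of_image_filter (f : G →ₙ* A) (aH := f a1) (bH := f b1)
    (by simp [hfa]) (by simp [hfb]) hu ?_
  intro x y hx hy hxy
  obtain ⟨hx, hfx⟩ := Finset.mem_filter.1 hx
  obtain ⟨hy, hfy⟩ := Finset.mem_filter.1 hy
  change f x = f a1 at hfx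
  change f y = f b1 at hfy
  have h1 : a1⁻¹ * x ∈ f.ker := by rw [MonoidHom.mem_ker, map_mul, map_inv, hfx]; simp
  have h2 : y * b1⁻¹ ∈ f.ker := by rw [MonoidHom.mem_ker, map_mul, map_inv, hfy]; simp
  have := hab (a := ⟨_, h1⟩) (b := ⟨_, h2⟩) (Finset.mem_preimage.2 (by simpa using hx))
    (Finset.mem_preimage.2 (by simpa using hy)) (by
    ext
    have h3 : x * y = a1 * ((a : G) * b) * b1 := by rw [hxy]; group
    simp only [Subgroup.coe_mul]
    calc a1⁻¹ * x * (y * b1⁻¹) = a1⁻¹ * (x * y) * b1⁻¹ := by group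
      _ = _ := by rw [h3]; group)
  obtain ⟨e1, e2⟩ := this
  rw [← e1, ← e2]
  constructor <;> simp

theorem uniqueProds_of_rationalDerived (n : ℕ) : ∀ (G : Type u) [Group G],
    rationalDerived G n = ⊥ → UniqueProds G := by
  induction n with
  | zero =>
    intro G _ h
    have : Subsingleton G := by
      rw [← Subgroup.subsingleton_iff]
      exact subsingleton_of_bot_eq_top h.symm
    exact ⟨fun {S T} hS hT => by
      obtain ⟨a, ha⟩ := hS
      obtain ⟨b, hb⟩ := hT
      exact ⟨a, ha, b, hb, fun _ _ _ _ _ => ⟨Subsingleton.elim _ _, Subsingleton.elim _ _⟩⟩⟩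
  | succ n ih =>
    intro G _ h
    refine uniqueProds_of_extension (QuotientGroup.mk' (rationalDerived G 1))
      (uniqueProds_of_commGroup _) ?_
    rw [QuotientGroup.ker_mk']
    apply ih
    have := map_subtype_rationalDerived_le G n
    rw [h, le_bot_iff] at this
    exact (Subgroup.map_eq_bot_iff_of_injective _ (Subgroup.subtype_injective _)).1 this


theorem exists_box {A : Type u} [CommGroup A] [DecidableEq A] (F : Finset A) :
    ∃ B : ℕ → Finset A, (B 0).Nonempty ∧
      (∀ k, ∀ x ∈ B k, ∀ y ∈ F, x * y ∈ B (k + 1)) ∧ ∀ k, (B k).card ≤ (k + 1) ^ F.card := by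
  refine ⟨fun k => (Fintype.piFinset (fun _ : F => Finset.range (k + 1))).image
    (fun e => ∏ f : F, (f : A) ^ e f), ?_, ?_, ?_⟩
  · refine Finset.Nonempty.image ⟨fun _ => 0, by simp⟩ _
  · intro k x hx y hy
    obtain ⟨e, he, rfl⟩ := Finset.mem_image.1 hx
    refine Finset.mem_image.2 ⟨e + Pi.single ⟨y, hy⟩ 1, ?_, ?_⟩
    · rw [Fintype.mem_piFinset] at he ⊢
      intro f
      have := Finset.mem_range.1 (he f)
      rw [Finset.mem_range, Pi.add_apply]
      by_cases h : f = ⟨y, hy⟩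
      · subst h; simp; omega
      · rw [Pi.single_eq_of_ne h]; omega
    · simp only [Pi.add_apply, pow_add, Finset.prod_mul_distrib]
      congr 1
      rw [Finset.prod_eq_single (⟨y, hy⟩ : F)]
      · simp
      · intro b _ hb; rw [Pi.single_eq_of_ne hb]; simp
      · simp
  · intro k
    refine Finset.card_image_le.trans ?_
    simp [Fintype.card_piFinset]

theorem exists_slow_growth (n d : ℕ) (a : ℕ → ℕ) (h0 : 0 < a 0)
    (ha : ∀ k, a k ≤ (k + 1) ^ d) : ∃ k, n * a (k + 1) < (n + 1) * a k := by
  by_contra! h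
  have h1 : ∀ k, (n + 1) ^ k ≤ n ^ k * a k := by
    intro k
    induction k with
    | zero => simpa using Nat.succ_le_of_lt h0
    | succ k ih =>
      calc (n + 1) ^ (k + 1) = (n + 1) * (n + 1) ^ k := by ring
        _ ≤ (n + 1) * (n ^ k * a k) := Nat.mul_le_mul_left _ ih
        _ = n ^ k * ((n + 1) * a k) := by ring
        _ ≤ n ^ k * (n * a (k + 1)) := Nat.mul_le_mul_left _ (h k)
        _ = _ := by ring
  have hr : |(n / (n + 1) : ℝ)| < 1 := by
    rw [abs_of_nonneg (by positivity), div_lt_one (by positivity)]; linarith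
  have ht := (tendsto_pow_const_mul_const_pow_of_abs_lt_one d hr)
  have hn : 0 < n := by
    rcases Nat.eq_zero_or_pos n with rfl | hn
    · have := h1 1; simp at this
    · exact hn
  have hpos : (0 : ℝ) < n / (n + 1) := by positivity
  obtain ⟨k, hk⟩ := ((ht.comp (Filter.tendsto_add_atTop_nat 1)).eventually
    (gt_mem_nhds (show (0 : ℝ) < n / (n + 1) by positivity))).exists
  have h2 : ((n : ℝ) + 1) ^ k ≤ n ^ k * (k + 1) ^ d := by
    have := (h1 k).trans (Nat.mul_le_mul_left _ (ha k))
    exact_mod_cast this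
  simp only [Function.comp_apply, Nat.cast_add, Nat.cast_one, pow_succ (n / (n + 1) : ℝ) k] at hk
  have h3 : ((k : ℝ) + 1) ^ d * (n / (n + 1)) ^ k < 1 := by
    rw [← mul_assoc] at hk
    by_contra! h4
    nlinarith
  rw [div_pow, mul_div_assoc', div_lt_one (by positivity)] at h3
  nlinarith

theorem strongRankCondition_of_extension {G A : Type u} [Group G] [CommGroup A] (f : G →* A)
    (hf : Function.Surjective f) (hN : StrongRankCondition (MonoidAlgebra ℤ f.ker)) :
    StrongRankCondition (MonoidAlgebra ℤ G) := by
  classical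
  rw [strongRankCondition_iff_succ]
  intro n φ hφ
  let ι : MonoidAlgebra ℤ f.ker →+* MonoidAlgebra ℤ G :=
    MonoidAlgebra.mapDomainRingHom ℤ f.ker.subtype
  let s : A → G := Function.surjInv hf
  have hs : ∀ a, f (s a) = a := Function.surjInv_eq hf
  have hinj : ∀ b : A, Function.Injective (fun x : f.ker => (x : G) * s b) :=
    fun b x y h => Subtype.ext (mul_right_cancel h)
  -- coordinates with respect to the coset representatives
  let c (b : A) : MonoidAlgebra ℤ G →+ MonoidAlgebra ℤ f.ker :=
    MonoidAlgebra.comapDomainAddMonoidHom _ (hinj b)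
  have hc_apply : ∀ b x (h : f.ker), (c b x).coeff h = x.coeff (h * s b) := by
    intro b x h; simp [c]
  have hc : ∀ b d x, c b (ι d * x) = d * c b x := by
    intro b d x
    induction d using MonoidAlgebra.induction_linear with
    | zero => simp
    | add d e hd he => rw [map_add, add_mul, add_mul, map_add, hd, he]
    | single h r =>
      ext h'
      rw [hc_apply]
      simp [ι, MonoidAlgebra.coeff_single_mul_apply, mul_assoc, hc_apply]
  have hι : ∀ d g, f g ≠ 1 → (ι d).coeff g = 0 := by
    intro d g hg
    refine Finsupp.mapDomain_of_notMem_range _ _ ?_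
    rintro ⟨h, rfl⟩
    exact hg h.2
  have hι' : ∀ d (h : f.ker), (ι d).coeff (h : G) = d.coeff h := fun d h =>
    Finsupp.mapDomain_apply f.ker.subtype_injective _ _
  -- finitely many cosets occur in the matrix of `φ`
  let M (i : Fin (n + 1)) (j : Fin n) : MonoidAlgebra ℤ G := φ (Pi.single i 1) j
  have hφM : ∀ x j, φ x j = ∑ i, x i * M i j := by
    intro x j
    conv_lhs => rw [pi_eq_sum_univ' x, map_sum]
    simp [M, Finset.sum_apply]
  let F : Finset A := Finset.univ.biUnion fun p : Fin (n + 1) × Fin n =>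
    (M p.1 p.2).coeff.support.image f
  obtain ⟨B, hB0, hBF, hBcard⟩ := exists_box F
  obtain ⟨k, hk⟩ := exists_slow_growth n F.card (fun k => (B k).card)
    (Finset.card_pos.2 hB0) hBcard
  let e (x : Fin (n + 1) × B k → MonoidAlgebra ℤ f.ker) (i : Fin (n + 1)) : MonoidAlgebra ℤ G :=
    ∑ b : B k, ι (x (i, b)) * MonoidAlgebra.single (s b) 1
  let Ψ : (Fin (n + 1) × B k → MonoidAlgebra ℤ f.ker) →ₗ[MonoidAlgebra ℤ f.ker]
      (Fin n × B (k + 1) → MonoidAlgebra ℤ f.ker) :=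
    { toFun := fun x p => c p.2 (φ (e x) p.1)
      map_add' := by
        intro x y
        have : e (x + y) = e x + e y := by
          ext1 i; simp [e, add_mul, Finset.sum_add_distrib]
        ext1 p; simp [this]
      map_smul' := by
        intro d x
        have : e (d • x) = ι d • e x := by
          ext1 i; simp [e, Finset.mul_sum, mul_assoc]
        ext1 p
        simp [this, hc] }
  have hΨ : Function.Injective Ψ := by
    rw [← LinearMap.ker_eq_bot, LinearMap.ker_eq_bot']
    intro x hx
    have h1 : φ (e x) = 0 := by
      ext1 j
      ext g
      by_contra hne
      have hg : f g ∈ B (k + 1) := by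
        rw [hφM, MonoidAlgebra.coeff_sum, Finsupp.finsetSum_apply] at hne
        obtain ⟨i, -, hi⟩ := Finset.exists_ne_zero_of_sum_ne_zero hne
        have hi' := MonoidAlgebra.support_coeff_mul_subset (e x i) (M i j) (Finsupp.mem_support_iff.2 hi)
        obtain ⟨g₁, hg₁, g₂, hg₂, rfl⟩ := Finset.mem_mul.1 hi'
        rw [map_mul]
        refine hBF k _ ?_ _ (Finset.mem_biUnion.2 ⟨(i, j), Finset.mem_univ _,
          Finset.mem_image_of_mem f hg₂⟩)
        have hg₁' := Finsupp.mem_support_iff.1 hg₁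
        simp only [e, MonoidAlgebra.coeff_sum, Finsupp.finsetSum_apply] at hg₁'
        obtain ⟨b, -, hb⟩ := Finset.exists_ne_zero_of_sum_ne_zero hg₁'
        rw [MonoidAlgebra.coeff_mul_single_apply, mul_one] at hb
        have h4 : f (g₁ * (s b)⁻¹) = 1 := by
          by_contra h5; exact hb (hι _ _ h5)
        rw [map_mul, map_inv, hs, mul_inv_eq_one] at h4
        rw [h4]; exact b.2
      have h5 : g * (s (f g))⁻¹ ∈ f.ker := by rw [MonoidHom.mem_ker, map_mul, map_inv, hs]; simp
      have h6 := congrArg (fun z => z.coeff ⟨_, h5⟩) (congrFun hx (j, ⟨f g, hg⟩))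
      simp only [Ψ, LinearMap.coe_mk, AddHom.coe_mk, hc_apply, inv_mul_cancel_right] at h6
      exact hne h6
    have h2 : e x = 0 := hφ (h1.trans (map_zero φ).symm)
    ext1 ⟨i, b⟩
    have h3 : c b (e x i) = x (i, b) := by
      ext h
      rw [hc_apply]
      simp only [e, MonoidAlgebra.coeff_sum, Finsupp.finsetSum_apply,
        MonoidAlgebra.coeff_mul_single_apply, mul_one]
      rw [Finset.sum_eq_single b]
      · rw [mul_inv_cancel_right, hι']
      · intro b' _ hb'
        refine hι _ _ ?_
        rw [map_mul, map_mul, map_inv, hs, hs, show f (h : G) = 1 from h.2, one_mul]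
        exact fun h7 => hb' (Subtype.ext (mul_inv_eq_one.1 h7).symm)
      · simp
    rw [← h3, h2]; simp
  have := card_le_of_injective _ Ψ hΨ
  simp at this
  omega

theorem strongRankCondition_of_rationalDerived (n : ℕ) : ∀ (G : Type u) [Group G],
    rationalDerived G n = ⊥ → StrongRankCondition (MonoidAlgebra ℤ G) := by
  induction n with
  | zero =>
    intro G _ h
    have : Subsingleton G := by
      rw [← Subgroup.subsingleton_iff]
      exact subsingleton_of_bot_eq_top h.symm
    let _ : CommGroup G := { mul_comm := fun _ _ => Subsingleton.elim _ _ }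
    infer_instance
  | succ n ih =>
    intro G _ h
    refine strongRankCondition_of_extension (QuotientGroup.mk' (rationalDerived G 1))
      (QuotientGroup.mk'_surjective _) ?_
    rw [QuotientGroup.ker_mk']
    apply ih
    have := map_subtype_rationalDerived_le G n
    rw [h, le_bot_iff] at this
    exact (Subgroup.map_eq_bot_iff_of_injective _ (Subgroup.subtype_injective _)).1 this

theorem isDomain_groupRing {G : Type u} [Group G] {n : ℕ} (h : rationalDerived G n = ⊥) :
    IsDomain (MonoidAlgebra ℤ G) :=
  have := uniqueProds_of_rationalDerived n G h
  inferInstance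

theorem nonempty_oreSet_groupRing {G : Type u} [Group G] {n : ℕ} (h : rationalDerived G n = ⊥) :
    Nonempty (OreLocalization.OreSet (MonoidAlgebra ℤ G)⁰) :=
  have := isDomain_groupRing h
  have := strongRankCondition_of_rationalDerived n G h
  nonempty_oreSet_of_strongRankCondition

/-- The inclusion of group rings. -/
noncomputable abbrev groupRingIncl {G : Type u} [Group G] (N : Subgroup G) :
    MonoidAlgebra ℤ N →+* MonoidAlgebra ℤ G :=
  MonoidAlgebra.mapDomainRingHom ℤ N.subtype

theorem groupRingIncl_injective {G : Type u} [Group G] (N : Subgroup G) :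
    Function.Injective (groupRingIncl N) := by
  intro x y h
  apply MonoidAlgebra.coeff_injective
  exact Finsupp.mapDomain_injective N.subtype_injective (congrArg MonoidAlgebra.coeff h)

theorem conj_groupRingIncl {G : Type u} [Group G] (N : Subgroup G) [N.Normal] (g : G)
    (x : MonoidAlgebra ℤ N) :
    groupRingIncl N (MonoidAlgebra.mapDomainRingHom ℤ (MulAut.conjNormal g : MulAut N).toMonoidHom x)
      * MonoidAlgebra.single g 1 = MonoidAlgebra.single g 1 * groupRingIncl N x := by
  induction x using MonoidAlgebra.induction_linear with
  | zero => simp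
  | add x y hx hy => simp only [map_add, add_mul, mul_add, hx, hy]
  | single h r => simp [MonoidAlgebra.single_mul_single]

theorem nonempty_oreSet_map {G : Type u} [Group G] (N : Subgroup G) [N.Normal]
    [IsDomain (MonoidAlgebra ℤ G)] [IsDomain (MonoidAlgebra ℤ N)]
    [OreLocalization.OreSet (MonoidAlgebra ℤ N)⁰] :
    Nonempty (OreLocalization.OreSet ((MonoidAlgebra ℤ N)⁰.map (groupRingIncl N))) := by
  rw [OreLocalization.nonempty_oreSet_iff_of_noZeroDivisors]
  intro r s
  induction r using MonoidAlgebra.induction_linear with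
  | zero => exact ⟨0, 1, by simp⟩
  | add r₁ r₂ h₁ h₂ =>
    obtain ⟨r₁', ⟨_, s₁, hs₁, rfl⟩, h₁⟩ := h₁
    obtain ⟨r₂', ⟨_, s₂, hs₂, rfl⟩, h₂⟩ := h₂
    have hore := OreLocalization.ore_eq s₁ (⟨s₂, hs₂⟩ : (MonoidAlgebra ℤ N)⁰)
    set d := OreLocalization.oreDenom s₁ (⟨s₂, hs₂⟩ : (MonoidAlgebra ℤ N)⁰)
    set u := OreLocalization.oreNum s₁ (⟨s₂, hs₂⟩ : (MonoidAlgebra ℤ N)⁰)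
    refine ⟨groupRingIncl N d * r₁' + groupRingIncl N u * r₂',
      ⟨groupRingIncl N (d * s₁), _, mul_mem d.2 hs₁, rfl⟩, ?_⟩
    simp only at h₁ h₂ hore ⊢
    rw [mul_add, add_mul]
    congr 1
    · rw [map_mul, mul_assoc, mul_assoc]; exact congrArg _ h₁
    · rw [hore, map_mul, mul_assoc, mul_assoc]; exact congrArg _ h₂
  | single g c =>
    obtain ⟨_, s, hs, rfl⟩ := s
    refine ⟨MonoidAlgebra.single g c, ⟨groupRingIncl N (MonoidAlgebra.mapDomainRingHom ℤ
      (MulAut.conjNormal g : MulAut N).toMonoidHom s), _, ?_, rfl⟩, ?_⟩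
    · rw [SetLike.mem_coe, mem_nonZeroDivisors_iff_ne_zero] at hs ⊢
      intro h0
      apply hs
      apply MonoidAlgebra.coeff_injective
      refine Finsupp.mapDomain_injective (MulAut.conjNormal g : MulAut N).injective ?_
      exact (congrArg MonoidAlgebra.coeff h0).trans (by simp)
    · have h := conj_groupRingIncl N g s
      have hc : (MonoidAlgebra.single g c : MonoidAlgebra ℤ G) = c • MonoidAlgebra.single g 1 := by
        simp
      simp only [hc, mul_smul_comm, smul_mul_assoc]
      exact congrArg _ h

section Degree

variable {G : Type u} [Group G]

theorem rationalDerived_le_ker (ψ : G →* Multiplicative ℤ) (n : ℕ) :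
    rationalDerived G (n + 1) ≤ ψ.ker := by
  have hanti : Antitone (rationalDerived G) := antitone_nat_of_succ_le (rationalDerived_antitone G)
  intro g hg
  obtain ⟨-, k, hk, hgk⟩ := hanti (show 1 ≤ n + 1 by omega) hg
  have h1 : g ^ k ∈ ψ.ker := (Abelianization.commutator_subset_ker ψ) hgk
  rw [MonoidHom.mem_ker, map_zpow, ← toAdd_eq_zero, toAdd_zpow, smul_eq_mul] at h1
  rw [MonoidHom.mem_ker, ← toAdd_eq_zero]
  exact (mul_eq_zero.1 h1).resolve_left hk

variable (G) in
/-- The group `Γ_n = G / G_r^(n+1)`. -/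
abbrev Gam (n : ℕ) : Type u := G ⧸ rationalDerived G (n + 1)

/-- The homomorphism `Γ_n → ℤ` induced by `ψ : G → ℤ`. -/
def psiBar (ψ : G →* Multiplicative ℤ) (n : ℕ) : Gam G n →* Multiplicative ℤ :=
  QuotientGroup.lift _ ψ (rationalDerived_le_ker ψ n)

/-- The kernel of the induced homomorphism `Γ_n → ℤ`. -/
abbrev GamBar (ψ : G →* Multiplicative ℤ) (n : ℕ) : Subgroup (Gam G n) := (psiBar ψ n).ker

theorem rationalDerived_GamBar (ψ : G →* Multiplicative ℤ) (n : ℕ) :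
    rationalDerived (GamBar ψ n) (n + 1) = ⊥ :=
  rationalDerived_eq_bot_of_injective _ (GamBar ψ n).subtype_injective _
    (rationalDerived_quotient G (n + 1))

instance isDomain_Gam (n : ℕ) : IsDomain (MonoidAlgebra ℤ (Gam G n)) :=
  isDomain_groupRing (rationalDerived_quotient G (n + 1))

instance isDomain_GamBar (ψ : G →* Multiplicative ℤ) (n : ℕ) :
    IsDomain (MonoidAlgebra ℤ (GamBar ψ n)) :=
  isDomain_groupRing (rationalDerived_GamBar ψ n)

noncomputable instance oreSet_GamBar (ψ : G →* Multiplicative ℤ) (n : ℕ) :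
    OreLocalization.OreSet (MonoidAlgebra ℤ (GamBar ψ n))⁰ :=
  Classical.choice (nonempty_oreSet_groupRing (rationalDerived_GamBar ψ n))

/-- The skew field `𝕂_n` of fractions of the Ore domain `ℤ[ker]`, where `ker` is the kernel of
`Γ_n → ℤ`. The domain satisfies the Ore condition on both sides (`g ↦ g⁻¹` exchanges the sides), so
the left ring of fractions used by Mathlib is also the classical right ring of quotients. -/
abbrev skewK (ψ : G →* Multiplicative ℤ) (n : ℕ) : Type u :=
  OreLocalization (MonoidAlgebra ℤ (GamBar ψ n))⁰ (MonoidAlgebra ℤ (GamBar ψ n))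

/-- The multiplicative set of the nonzero elements of `ℤ[ker]`, inside `ℤ[Γ_n]`, where `ker` is the
kernel of `Γ_n → ℤ`. (`ℤ[ker]` is a domain, so its nonzero elements are its nonzerodivisors.) -/
noncomputable abbrev denomS (ψ : G →* Multiplicative ℤ) (n : ℕ) : Submonoid (MonoidAlgebra ℤ (Gam G n)) :=
  (MonoidAlgebra ℤ (GamBar ψ n))⁰.map (groupRingIncl (GamBar ψ n))

noncomputable instance oreSet_denomS (ψ : G →* Multiplicative ℤ) (n : ℕ) :
    OreLocalization.OreSet (denomS ψ n) :=
  Classical.choice (nonempty_oreSet_map (GamBar ψ n))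

/-- The localization `R_n` of `ℤ[Γ_n]` at the nonzero elements of `ℤ[ker]`, a two-sided Ore set. -/
abbrev ringR (ψ : G →* Multiplicative ℤ) (n : ℕ) : Type u :=
  OreLocalization (denomS ψ n) (MonoidAlgebra ℤ (Gam G n))

/-- The canonical homomorphism `𝕂_n → R_n`, which extends the inclusion `ℤ[ker] → ℤ[Γ_n]`. -/
noncomputable def skewKToRingR (ψ : G →* Multiplicative ℤ) (n : ℕ) : skewK ψ n →+* ringR ψ n :=
  OreLocalization.universalHom
    (OreLocalization.numeratorRingHom.comp (groupRingIncl (GamBar ψ n)))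
    (IsUnit.liftRight (((OreLocalization.numeratorRingHom (S := denomS ψ n)).comp
      (groupRingIncl (GamBar ψ n))).toMonoidHom.comp (MonoidAlgebra ℤ (GamBar ψ n))⁰.subtype)
      fun s => OreLocalization.numerator_isUnit (⟨_, _, s.2, rfl⟩ : denomS ψ n))
    (fun _ => rfl)

/-- The composite `G → Γ_n → ℤ[Γ_n] → R_n`, the coefficient system of the homology below. -/
noncomputable def coeffHom (ψ : G →* Multiplicative ℤ) (n : ℕ) : G →* ringR ψ n :=
  ((OreLocalization.numeratorRingHom (S := denomS ψ n)).toMonoidHom.comp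
    (MonoidAlgebra.of ℤ (Gam G n))).comp (QuotientGroup.mk' (rationalDerived G (n + 1)))

end Degree

section LocalCoefficients

open scoped DirectSum

variable {X : Type u} [TopologicalSpace X] {x₀ : X} {R : Type u} [Ring R]

/-- A homomorphism `ρ` from `π₁(X, x₀)` to the multiplicative monoid of `R` defines a local system of
right `R`-modules on (the path component of `x₀` in) `X`, the flat bundle `X~ ×_π R`. Its fibre at
`x` consists of the functions `s` from homotopy classes of paths `p : x₀ → x` to `R` such that
`ρ g * s (g · p) = s p`; parallel transport along a path `γ : x → y` sends `s` to `s'` with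
`s' (p · γ) = s p`. This is the right `R`-module of flat sections of the pullback of the local
system along `σ : T → X`. (In Mathlib's fundamental group, `g * h` is `h` followed by `g`, so that
`p ↦ g · p` is a right action, and `s` corresponds to the element `p ⊗ s p` of the tensor product
over the group ring, which does not depend on `p`.) -/
def flatSubmodule (ρ : FundamentalGroup X x₀ →* R) {T : Type} [TopologicalSpace T] (σ : C(T, X)) :
    Submodule Rᵐᵒᵖ (∀ v : T, Path.Homotopic.Quotient x₀ (σ v) → R) where
  carrier := {s |
    (∀ v (g : FundamentalGroup X x₀) (p : Path.Homotopic.Quotient x₀ (σ v)),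
      ρ g * s v (g.toPath.trans p) = s v p) ∧
    (∀ v w (γ : Path v w) (p : Path.Homotopic.Quotient x₀ (σ v)),
      s w (p.trans (.mk (γ.map σ.continuous))) = s v p)}
  zero_mem' := by simp
  add_mem' := by
    rintro a b ⟨ha, ha'⟩ ⟨hb, hb'⟩
    exact ⟨fun v g p => by simp [mul_add, ha, hb], fun v w γ p => by simp [ha', hb']⟩
  smul_mem' := by
    rintro r a ⟨ha, ha'⟩
    exact ⟨fun v g p => by simp [← mul_assoc, ha], fun v w γ p => by simp [ha']⟩

/-- Flat sections of the local system of `ρ` over `σ : T → X`. For `T` a simplex this is a copy of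
the fibre of the local system at any vertex. -/
def FlatSection (ρ : FundamentalGroup X x₀ →* R) {T : Type} [TopologicalSpace T]
    (σ : C(T, X)) : Type u := flatSubmodule ρ σ

instance FlatSection.addCommGroup (ρ : FundamentalGroup X x₀ →* R) {T : Type}
    [TopologicalSpace T] (σ : C(T, X)) : AddCommGroup (FlatSection ρ σ) :=
  inferInstanceAs (AddCommGroup (flatSubmodule ρ σ))

instance FlatSection.module (ρ : FundamentalGroup X x₀ →* R) {T : Type}
    [TopologicalSpace T] (σ : C(T, X)) : Module Rᵐᵒᵖ (FlatSection ρ σ) :=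
  inferInstanceAs (Module Rᵐᵒᵖ (flatSubmodule ρ σ))

/-- Pullback of flat sections along `d : T' → T`. -/
def FlatSection.restrict (ρ : FundamentalGroup X x₀ →* R) {T T' : Type} [TopologicalSpace T]
    [TopologicalSpace T'] (σ : C(T, X)) (d : C(T', T)) :
    FlatSection ρ σ →ₗ[Rᵐᵒᵖ] FlatSection ρ (σ.comp d) where
  toFun s := ⟨fun v => s.1 (d v), fun v => s.2.1 (d v),
    fun v w γ => s.2.2 (d v) (d w) (γ.map d.continuous)⟩
  map_add' _ _ := rfl
  map_smul' _ _ := rfl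

/-- The inclusion of the `i`-th face of the standard `(k+1)`-simplex. -/
noncomputable def faceMap (k : ℕ) (i : Fin (k + 2)) :
    C(stdSimplex ℝ (Fin (k + 1)), stdSimplex ℝ (Fin (k + 2))) :=
  ⟨stdSimplex.map i.succAbove, stdSimplex.continuous_map _⟩

/-- Singular `k`-chains of `X` with coefficients in the local system of `ρ`: finite sums of singular
simplices `σ`, each with a flat section of the local system over `σ` as coefficient. -/
abbrev LocalChains (ρ : FundamentalGroup X x₀ →* R) (k : ℕ) : Type u :=
  ⨁ σ : C(stdSimplex ℝ (Fin (k + 1)), X), FlatSection ρ σ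

open Classical in
/-- The boundary `∂ (σ, s) = ∑ᵢ (-1)ⁱ (σ ∘ δᵢ, s restricted to the i-th face)`. -/
noncomputable def localBoundary (ρ : FundamentalGroup X x₀ →* R) (k : ℕ) :
    LocalChains ρ (k + 1) →ₗ[Rᵐᵒᵖ] LocalChains ρ k :=
  DirectSum.toModule Rᵐᵒᵖ _ _ fun σ => ∑ i : Fin (k + 2), (-1 : ℤ) ^ (i : ℕ) •
    (DirectSum.lof Rᵐᵒᵖ (C(stdSimplex ℝ (Fin (k + 1)), X)) (fun τ => FlatSection ρ τ)
      (σ.comp (faceMap k i)) ∘ₗ FlatSection.restrict ρ σ (faceMap k i))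

/-- The first singular homology `H₁(X; R)` with coefficients in the local system of `ρ`,
a right `R`-module. -/
abbrev LocalH1 (ρ : FundamentalGroup X x₀ →* R) : Type u :=
  LinearMap.ker (localBoundary ρ 0) ⧸
    (LinearMap.range (localBoundary ρ 1)).submoduleOf (LinearMap.ker (localBoundary ρ 0))

end LocalCoefficients

/-- The `n`-th order degree of a pointed space with a homomorphism `ψ : π₁ → ℤ`: the rank over
`𝕂_n` of the right `R_n`-module `H₁(X; R_n)`, an element of `{0, 1, 2, …, ∞}`. -/
noncomputable def higherOrderDegree {X : Type u} [TopologicalSpace X] {x₀ : X}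
    (ψ : FundamentalGroup X x₀ →* Multiplicative ℤ) (n : ℕ) : ℕ∞ :=
  letI : Module (skewK ψ n)ᵐᵒᵖ (LocalH1 (coeffHom ψ n)) :=
    Module.compHom _ (RingHom.op (skewKToRingR ψ n))
  Cardinal.toENat (Module.rank (skewK ψ n)ᵐᵒᵖ (LocalH1 (coeffHom ψ n)))

section Linking

theorem zmultiplesHom_two_pi_I_injective :
    Function.Injective (zmultiplesHom ℂ (2 * Real.pi * Complex.I)) := by
  intro a b h
  simpa [Complex.two_pi_I_ne_zero] using h

/-- The isomorphism `k ↦ 2πi k` from `ℤ` to `2πiℤ`. -/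
noncomputable def periodEquiv : ℤ ≃+ AddSubgroup.zmultiples (2 * Real.pi * Complex.I : ℂ) :=
  (AddMonoidHom.ofInjective zmultiplesHom_two_pi_I_injective).trans
    (AddEquiv.addSubgroupCongr (AddSubgroup.range_zmultiplesHom _))

/-- The winding number around `0` of loops in `ℂ ∖ {0}`, as a homomorphism to `ℤ`. -/
noncomputable def windingHom (z : {z : ℂ // z ≠ 0}) :
    FundamentalGroup {z : ℂ // z ≠ 0} z →* Multiplicative ℤ :=
  periodEquiv.symm.toMultiplicative.toMonoidHom.comp
    (MulOpposite.opMulEquiv.symm.toMonoidHom.comp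
      (Complex.isAddQuotientCoveringMap_exp.fundamentalGroupToMulOpposite
        ⟨Complex.log z, Subtype.ext (Complex.exp_log z.2)⟩))

/-- The winding number of `γ = exp ∘ θ` is `(θ(1) - θ(0)) / 2πi`. -/
theorem windingHom_spec {z : {z : ℂ // z ≠ 0}} (γ : Path z z) (θ : C(unitInterval, ℂ))
    (hθ : ∀ t, Complex.exp (θ t) = γ t) :
    θ 1 - θ 0 = (windingHom z (.fromPath (.mk γ))).toAdd * (2 * Real.pi * Complex.I) := by
  let cov := Complex.isAddQuotientCoveringMap_exp
  let e : (fun z : ℂ => (⟨_, z.exp_ne_zero⟩ : {z : ℂ // z ≠ 0})) ⁻¹' {z} :=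
    ⟨Complex.log z, Subtype.ext (Complex.exp_log z.2)⟩
  have h1 := cov.unop_fundamentalGroupToMulOpposite_smul (e := e) (γ := .fromPath (.mk γ))
  let a := cov.fundamentalGroupToMulOpposite e (.fromPath (.mk γ))
  have h2 : ((windingHom z (.fromPath (.mk γ))).toAdd : ℂ) * (2 * Real.pi * Complex.I)
      = (a.unop.toAdd : ℂ) := by
    have h3 : ∀ k : ℤ, (periodEquiv k : ℂ) = k * (2 * Real.pi * Complex.I) := fun k => by
      change k • (2 * Real.pi * Complex.I : ℂ) = _
      rw [zsmul_eq_mul]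
    rw [← h3]
    exact congrArg Subtype.val (periodEquiv.apply_symm_apply a.unop.toAdd)
  have h4 : θ - ContinuousMap.const _ (θ 0 - Complex.log z) =
      cov.isCoveringMap.liftPath γ (Complex.log z) (γ.source.trans e.2.symm) := by
    rw [IsCoveringMap.eq_liftPath_iff']
    refine ⟨?_, by simp⟩
    ext t
    simp [Complex.exp_sub, hθ, Complex.exp_log z.2, div_self z.2]
  have h5 := congrArg (fun g => g 1) h4
  have h6 : (a.unop.toAdd : ℂ) + Complex.log z =
      cov.isCoveringMap.liftPath γ (Complex.log z) (γ.source.trans e.2.symm) 1 := h1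
  rw [h2]
  simp only [ContinuousMap.sub_apply, ContinuousMap.const_apply] at h5
  rw [← h6] at h5
  linear_combination h5

/-- The complement in `ℂ²` of the affine plane curve `f = 0`. -/
abbrev CurveComplement (f : MvPolynomial (Fin 2) ℂ) : Type :=
  {z : Fin 2 → ℂ // MvPolynomial.eval z f ≠ 0}

/-- The map `f` from the complement of the curve `f = 0` to `ℂ ∖ {0}`. -/
noncomputable def evalComplement (f : MvPolynomial (Fin 2) ℂ) : C(CurveComplement f, {z : ℂ // z ≠ 0}) where
  toFun z := ⟨MvPolynomial.eval z.1 f, z.2⟩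
  continuous_toFun := by
    refine Continuous.subtype_mk ?_ _
    exact (MvPolynomial.continuous_eval f).comp continuous_subtype_val

/-- The linking number homomorphism `α ↦ lk(α, C)` of the curve `C = {f = 0}`, with `f` reduced: the
winding number of `f ∘ α` around `0`. It sends each positive meridian of `C` to `1`. -/
noncomputable def linkingHom (f : MvPolynomial (Fin 2) ℂ) (u₀ : CurveComplement f) :
    FundamentalGroup (CurveComplement f) u₀ →* Multiplicative ℤ :=
  (windingHom (evalComplement f u₀)).comp (FundamentalGroup.map (evalComplement f) u₀)

/-- The `n`-th order degree `δ_n(C)` of the affine plane curve `C = {f = 0}`, with `f` reduced,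
computed with base point `u₀`. -/
noncomputable def curveHigherOrderDegree (f : MvPolynomial (Fin 2) ℂ) (u₀ : CurveComplement f) (n : ℕ) : ℕ∞ :=
  higherOrderDegree (linkingHom f u₀) n

end Linking

end HigherDegree

/-!
Choose a linear form `u` that is constant on the lines `L i`, so that the curve is `u ∈ {c i}` with
distinct `c i` and its complement `X` is the preimage of `ℂ ∖ {c i}` under `u`.

*One line.* `X` is homotopy equivalent to `ℂ ∖ {0}`, and `π₁(X)` is infinite cyclic, with a generator
`x`. Modulo boundaries every 1-cycle with local coefficients is a single loop `x` with some
coefficient `r`, with boundary `(x - 1) r`. The rational derived subgroups lie in the kernel of every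
homomorphism to `ℤ`, so `x - 1` is not zero in the domain `ℤ[Γ_n]`, hence regular in `R_n`, and
`H₁(X; R_n) = 0` (`subsingleton_localH1_of_cyclic`, `higherOrderDegree_eq_zero`).

*Several lines.* After a rotation and a translation of `u`, no `c i` has real part `0` and both signs
occur. For small `ε`, the sets `Re u < ε` and `-ε < Re u` cover `X`, and their intersection is convex,
so that the local system is trivial on it. The boundary map of the Mayer–Vietoris sequence is then an
`R_n`-linear functional on `H₁(X; R_n)`. It is constructed by hand: over the part
of a simplex that lies in the intersection, the trivialization turns a flat section into a locally
constant function, which is a difference of locally constant functions on the two parts of the simplex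
since simplices are simply connected, and the functional measures the jump of the latter between the
end points of an edge
(`CutCover.functional`, `CutCover.functional_boundary`). Two loops `g₁`, `g₂`, one in each set, with
coefficients such that `(g₁ - 1) r₁ = (g₂ - 1) r₂` form a cycle on which the functional takes this
common value (`CutCover.exists_functional_localH1`). Large circles, run through a suitable number of
times, provide such loops with the same nonzero linking number `d`
(`curveHigherOrderDegree_eq_top_of_re`).

Put `t = g₁` and `g₂ = t k`, with `k` in `𝕂_n`. The right ideals `(t - 1) R_n` and `(t k - 1) R_n` have a
common element `e = t² α + t β + γ` with `α, β, γ` in `𝕂_n` and `α ≠ 0` (`exists_common_multiple`).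
The multiples `e t³ʲ` occupy disjoint ranges of the grading of `R_n` by the linking number, so they
are linearly independent over `𝕂_n`, and `H₁(X; R_n)` has infinite rank (`toENat_rank_eq_top`).
-/

namespace HigherDegree

open Filter Topology

/-! ### Čech `H¹` of a simply connected space -/

/-- The vanishing of the first cohomology of a simply connected space `T`, for a cover by two open
sets: a locally constant function `w` on the intersection is a difference of locally constant
functions on `T₁` and `T₂`. They are the two coordinates of a section of the covering space with
fibre `M` that `w` glues from the trivial coverings of `T₁` and `T₂`. -/
theorem exists_locallyConst_sub {T : Type*} [TopologicalSpace T] [SimplyConnectedSpace T]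
    [LocallyPathConnectedSpace T] {M : Type*} [AddCommGroup M] {T₁ T₂ : Set T}
    (h₁ : IsOpen T₁) (h₂ : IsOpen T₂) (hT : ∀ v, v ∈ T₁ ∨ v ∈ T₂) (w : T → M)
    (hw : ∀ v ∈ T₁ ∩ T₂, ∀ᶠ v' in 𝓝 v, w v' = w v) :
    ∃ b₁ b₂ : T → M, (∀ v ∈ T₁, ∀ᶠ v' in 𝓝 v, b₁ v' = b₁ v) ∧
      (∀ v ∈ T₂, ∀ᶠ v' in 𝓝 v, b₂ v' = b₂ v) ∧ ∀ v ∈ T₁ ∩ T₂, b₁ v - b₂ v = w v := by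
  classical
  let _ : TopologicalSpace M := ⊥
  have : DiscreteTopology M := ⟨rfl⟩
  let h : Bool → T → M := fun i v => if i then w v else 0
  let B : Bool → Set T := fun i => if i then T₁ else T₂
  have hB : ∀ i, IsOpen (B i) := fun i => by cases i <;> simp [B, h₁, h₂]
  have hh : ∀ i j, ∀ v ∈ B i ∩ B j, ∀ᶠ v' in 𝓝 v, h j v' - h i v' = h j v - h i v := by
    intro i j v hv
    by_cases hij : i = j
    · subst hij; simp
    · have hv' : v ∈ T₁ ∩ T₂ := by
        cases i <;> cases j <;> simp [B, and_comm] at hij hv ⊢ <;> exact hv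
      filter_upwards [hw v hv'] with v' e
      cases i <;> cases j <;> simp [h, e]
  let Z : FiberBundleCore Bool T M :=
    { baseSet := B
      isOpen_baseSet := hB
      indexAt := fun v => decide (v ∈ T₁)
      mem_baseSet_at := fun v => by
        by_cases hv : v ∈ T₁
        · simp [B, hv]
        · simpa [B, hv] using (hT v).resolve_left hv
      coordChange := fun i j v x => x + (h j v - h i v)
      coordChange_self := by simp
      continuousOn_coordChange := by
        rintro i j ⟨v, x⟩ ⟨hv, -⟩
        refine ContinuousAt.continuousWithinAt ?_
        refine (continuousAt_snd).add ?_
        have : (fun p : T × M => h j p.1 - h i p.1) =ᶠ[𝓝 (v, x)] fun _ => h j v - h i v :=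
          (continuous_fst.tendsto (v, x)).eventually (hh i j v hv)
        exact this.continuousAt
      coordChange_comp := by intro i j k v _ x; abel }
  have cov : IsCoveringMap Z.proj := FiberBundle.isCoveringMap
  obtain ⟨v₀⟩ : Nonempty T := inferInstance
  obtain ⟨F, ⟨-, hF⟩, -⟩ := cov.existsUnique_continuousMap_lifts (ContinuousMap.id T) v₀
    (⟨v₀, (0 : M)⟩ : Z.TotalSpace) rfl
  have hF' : ∀ v, (F v).1 = v := fun v => congrFun hF v
  let b : Bool → T → M := fun i v => (Z.localTriv i (F v)).2
  have hb : ∀ i, ∀ v ∈ B i, ∀ᶠ v' in 𝓝 v, b i v' = b i v := by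
    intro i v hv
    have hv' : F v ∈ (Z.localTriv i).source := by
      rw [Bundle.Trivialization.mem_source]
      simpa only [hF'] using! hv
    have : ContinuousAt (b i) v :=
      continuousAt_snd.comp (f := fun v => Z.localTriv i (F v))
        (((Z.localTriv i).continuousOn_toFun.continuousAt
          ((Z.localTriv i).open_source.mem_nhds hv')).comp F.continuous.continuousAt)
    exact this.eventually (f := b i) (p := fun y => y = b i v)
      ((isOpen_discrete {b i v}).mem_nhds rfl)
  refine ⟨b true, b false, fun v hv => hb true v (by simpa [B]), fun v hv => hb false v (by simpa [B]),
    fun v hv => ?_⟩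
  let y : M := (F v).2
  have e : ∀ i, b i v = y + (h i (F v).1 - h (Z.indexAt (F v).1) (F v).1) := fun i => rfl
  rw [e, e, hF']
  simp [h]

theorem Convex.locallyPathConnectedSpace {E : Type*} [NormedAddCommGroup E] [NormedSpace ℝ E]
    {s : Set E} (hs : Convex ℝ s) : LocallyPathConnectedSpace s := by
  refine LocallyPathConnectedSpace.of_bases (p := fun _ r => (0 : ℝ) < r)
    (s := fun x r => Metric.ball x r) (fun x => Metric.nhds_basis_ball) fun x r hr => ?_
  have h1 : IsPathConnected (Metric.ball (x : E) r ∩ s) :=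
    ((convex_ball (x : E) r).inter hs).isPathConnected ⟨x, Metric.mem_ball_self hr, x.2⟩
  rw [Topology.IsInducing.subtypeVal.isPathConnected_iff]
  convert h1 using 1
  ext y
  simp only [Set.mem_image, Metric.mem_ball, Subtype.exists, exists_and_right, exists_eq_right,
    Set.mem_inter_iff]
  constructor
  · rintro ⟨hy, h⟩; exact ⟨h, hy⟩
  · rintro ⟨h, hy⟩; exact ⟨hy, h⟩

instance simplyConnectedSpace_stdSimplex (k : ℕ) :
    SimplyConnectedSpace (stdSimplex ℝ (Fin (k + 1))) :=
  have := (convex_stdSimplex ℝ (Fin (k + 1))).contractibleSpace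
    ⟨_, (stdSimplex.vertex (S := ℝ) (0 : Fin (k + 1))).2⟩
  inferInstance

instance locallyPathConnectedSpace_stdSimplex (k : ℕ) :
    LocallyPathConnectedSpace (stdSimplex ℝ (Fin (k + 1))) :=
  Convex.locallyPathConnectedSpace (convex_stdSimplex ℝ (Fin (k + 1)))

/-! ### Flat sections over a simply connected space -/

section FlatSections

variable {X : Type u} [TopologicalSpace X] {x₀ : X} {R : Type u} [Ring R]

theorem quotient_trans_right_cancel {x y z : X} {a b : Path.Homotopic.Quotient x y}
    (p : Path.Homotopic.Quotient y z) (h : a.trans p = b.trans p) : a = b := by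
  have := congrArg (fun c => c.trans p.symm) h
  simpa using this

/-- The loop `q p⁻¹`, which moves the path `p` to the path `q` with the same endpoint. -/
noncomputable def loopOf {y : X} (q p : Path.Homotopic.Quotient x₀ y) : FundamentalGroup X x₀ :=
  .fromPath (q.trans p.symm)

theorem loopOf_trans {y : X} (q p : Path.Homotopic.Quotient x₀ y) :
    (loopOf q p).toPath.trans p = q := by
  change (q.trans p.symm).trans p = q
  simp

theorem eq_loopOf {y : X} {q p : Path.Homotopic.Quotient x₀ y} {g : FundamentalGroup X x₀}
    (h : g.toPath.trans p = q) : g = loopOf q p :=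
  quotient_trans_right_cancel p (h.trans (loopOf_trans q p).symm)

theorem inv_mul_trans {y : X} (g l : FundamentalGroup X x₀) (p : Path.Homotopic.Quotient x₀ y) :
    (g⁻¹ * l).toPath.trans (g.toPath.trans p) = l.toPath.trans p := by
  rw [← Path.Homotopic.Quotient.trans_assoc]
  congr 1
  change (g * (g⁻¹ * l)).toPath = _
  rw [mul_inv_cancel_left]

variable (ρ : FundamentalGroup X x₀ →* R) {T T' : Type} [TopologicalSpace T] [TopologicalSpace T']

theorem isUnit_map_group {G M : Type*} [Group G] [Monoid M] (ρ : G →* M) (g : G) : IsUnit (ρ g) :=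
  (Group.isUnit g).map ρ

namespace FlatSection

variable {ρ} {σ : C(T, X)}

theorem map_mul_apply (s : FlatSection ρ σ) {v : T} (g : FundamentalGroup X x₀)
    (p : Path.Homotopic.Quotient x₀ (σ v)) : ρ g * s.1 v (g.toPath.trans p) = s.1 v p :=
  s.2.1 v g p

theorem apply_trans_path (s : FlatSection ρ σ) {v w : T} (γ : Path v w)
    (p : Path.Homotopic.Quotient x₀ (σ v)) :
    s.1 w (p.trans (.mk (γ.map σ.continuous))) = s.1 v p :=
  s.2.2 v w γ p

@[simp] theorem add_val (s t : FlatSection ρ σ) (v : T) (p : Path.Homotopic.Quotient x₀ (σ v)) :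
    (s + t).1 v p = s.1 v p + t.1 v p := rfl

@[simp] theorem smul_val (r : Rᵐᵒᵖ) (s : FlatSection ρ σ) (v : T)
    (p : Path.Homotopic.Quotient x₀ (σ v)) : (r • s).1 v p = s.1 v p * r.unop := rfl

/-- A flat section over a path connected space is determined by one value. -/
theorem ext_of_apply [PathConnectedSpace T] {s t : FlatSection ρ σ} (v : T)
    (p : Path.Homotopic.Quotient x₀ (σ v)) (h : s.1 v p = t.1 v p) : s = t := by
  apply Subtype.ext
  funext w p'
  let γ : Path v w := PathConnectedSpace.somePath v w
  let q := p.trans (.mk (γ.map σ.continuous))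
  have hs : ∀ s : FlatSection ρ σ, ρ (loopOf p' q) * s.1 w p' = s.1 v p := by
    intro s
    have := s.map_mul_apply (loopOf p' q) q
    rwa [loopOf_trans, s.apply_trans_path] at this
  exact (isUnit_map_group ρ _).mul_left_cancel ((hs s).trans (h.trans (hs t).symm))

/-- A flat section with a prescribed value exists over a simply connected space. -/
theorem exists_apply_eq [SimplyConnectedSpace T] (σ : C(T, X)) (v : T)
    (p : Path.Homotopic.Quotient x₀ (σ v)) (r : R) : ∃ s : FlatSection ρ σ, s.1 v p = r := by
  let q : ∀ w, Path.Homotopic.Quotient x₀ (σ w) := fun w =>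
    p.trans (.mk ((PathConnectedSpace.somePath v w).map σ.continuous))
  have hq : ∀ w w' (γ : Path w w'), (q w).trans (.mk (γ.map σ.continuous)) = q w' := by
    intro w w' γ
    simp only [q, Path.Homotopic.Quotient.trans_assoc, ← Path.Homotopic.Quotient.mk_trans,
      ← Path.map_trans]
    congr 1
    rw [Path.Homotopic.Quotient.eq]
    exact (SimplyConnectedSpace.paths_homotopic _ _).map σ
  refine ⟨⟨fun w p' => ρ (loopOf (q w) p') * r, fun w g p' => ?_, fun w w' γ p' => ?_⟩, ?_⟩
  · have : g⁻¹ * loopOf (q w) p' = loopOf (q w) (g.toPath.trans p') :=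
      eq_loopOf (by rw [inv_mul_trans, loopOf_trans])
    beta_reduce
    rw [← this, ← mul_assoc, ← map_mul, mul_inv_cancel_left]
  · have : loopOf (q w) p' = loopOf (q w') (p'.trans (.mk (γ.map σ.continuous))) :=
      eq_loopOf (by rw [← Path.Homotopic.Quotient.trans_assoc, loopOf_trans, hq])
    change _ = ρ (loopOf (q w) p') * r
    rw [this]
  · have hv : q v = p := by
      have h1 : (.mk ((PathConnectedSpace.somePath v v).map σ.continuous) :
          Path.Homotopic.Quotient (σ v) (σ v)) = .mk ((Path.refl v).map σ.continuous) := by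
        rw [Path.Homotopic.Quotient.eq]
        exact (SimplyConnectedSpace.paths_homotopic _ _).map σ
      simp only [q, h1]
      exact Path.Homotopic.Quotient.trans_refl p
    have : (1 : FundamentalGroup X x₀) = loopOf (q v) p :=
      eq_loopOf (by rw [hv]; exact Path.Homotopic.Quotient.refl_trans p)
    change ρ (loopOf (q v) p) * r = r
    rw [← this, map_one, one_mul]

variable (ρ) in
/-- The flat section over a simply connected space with the value `r` at `(v, p)`. -/
noncomputable def ofValue [SimplyConnectedSpace T] (σ : C(T, X)) (v : T)
    (p : Path.Homotopic.Quotient x₀ (σ v)) (r : R) : FlatSection ρ σ :=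
  (exists_apply_eq σ v p r).choose

@[simp] theorem ofValue_apply [SimplyConnectedSpace T] (σ : C(T, X)) (v : T)
    (p : Path.Homotopic.Quotient x₀ (σ v)) (r : R) : (ofValue ρ σ v p r).1 v p = r :=
  (exists_apply_eq σ v p r).choose_spec

theorem ofValue_smul [SimplyConnectedSpace T] (σ : C(T, X)) (v : T)
    (p : Path.Homotopic.Quotient x₀ (σ v)) (r : R) (a : Rᵐᵒᵖ) :
    a • ofValue ρ σ v p r = ofValue ρ σ v p (r * a.unop) :=
  ext_of_apply v p (by simp)

theorem ofValue_add [SimplyConnectedSpace T] (σ : C(T, X)) (v : T)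
    (p : Path.Homotopic.Quotient x₀ (σ v)) (r r' : R) :
    ofValue ρ σ v p (r + r') = ofValue ρ σ v p r + ofValue ρ σ v p r' :=
  ext_of_apply v p (by simp)

end FlatSection

end FlatSections

/-! ### The Mayer–Vietoris boundary functional -/

theorem faceMap_vertex (k : ℕ) (i : Fin (k + 2)) (j : Fin (k + 1)) :
    faceMap k i (stdSimplex.vertex j) = stdSimplex.vertex (i.succAbove j) :=
  stdSimplex.map_vertex _ _

section MayerVietoris

open scoped DirectSum

variable {X : Type u} [TopologicalSpace X] {x₀ : X} {R : Type u} [Ring R]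

variable (x₀) in
/-- A cover of `X` by two open sets, with paths from `x₀` to the points of the intersection that
form a flat family: the path to `x`, followed by a path in the intersection from `x` to `y`, is
homotopic to the path to `y`. Such a family trivializes every local system on the intersection. -/
structure CutCover where
  /-- The first open set. -/
  V₁ : Set X
  /-- The second open set. -/
  V₂ : Set X
  isOpen₁ : IsOpen V₁
  isOpen₂ : IsOpen V₂
  cover : ∀ x, x ∈ V₁ ∨ x ∈ V₂
  /-- The path from the base point to a point of the intersection. -/
  tail : ∀ x, x ∈ V₁ ∩ V₂ → Path.Homotopic.Quotient x₀ x
  tail_trans : ∀ x y (hx : x ∈ V₁ ∩ V₂) (hy : y ∈ V₁ ∩ V₂) (γ : Path x y),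
    (∀ t, γ t ∈ V₁ ∩ V₂) → (tail x hx).trans (.mk γ) = tail y hy

namespace CutCover

variable {ρ : FundamentalGroup X x₀ →* R} {T T' : Type} [TopologicalSpace T] [TopologicalSpace T']
  (𝒱 : CutCover x₀)

/-- A potential of a flat section `s` over `σ : T → X`: locally constant functions `b₁`, `b₂` on the
preimages of the two open sets, whose difference on the preimage of the intersection is the value
of `s` along the paths `𝒱.tail`. -/
structure IsPotential {σ : C(T, X)} (s : FlatSection ρ σ) (b₁ b₂ : T → R) : Prop where
  locallyConst₁ : ∀ v, σ v ∈ 𝒱.V₁ → ∀ᶠ v' in 𝓝 v, b₁ v' = b₁ v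
  locallyConst₂ : ∀ v, σ v ∈ 𝒱.V₂ → ∀ᶠ v' in 𝓝 v, b₂ v' = b₂ v
  sub_eq : ∀ v (h : σ v ∈ 𝒱.V₁ ∩ 𝒱.V₂), b₁ v - b₂ v = s.1 v (𝒱.tail _ h)

open Classical in
/-- The value of a potential at a point: that of `b₂` where it is meaningful, that of `b₁` on the
rest. -/
noncomputable def potVal (σ : C(T, X)) (b₁ b₂ : T → R) (v : T) : R :=
  if σ v ∈ 𝒱.V₂ then b₂ v else b₁ v

variable {𝒱}

theorem exists_isPotential [SimplyConnectedSpace T] [LocallyPathConnectedSpace T] {σ : C(T, X)}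
    (s : FlatSection ρ σ) : ∃ b₁ b₂, 𝒱.IsPotential s b₁ b₂ := by
  classical
  let w : T → R := fun v => if h : σ v ∈ 𝒱.V₁ ∩ 𝒱.V₂ then s.1 v (𝒱.tail _ h) else 0
  have hw : ∀ v ∈ σ ⁻¹' 𝒱.V₁ ∩ σ ⁻¹' 𝒱.V₂, ∀ᶠ v' in 𝓝 v, w v' = w v := by
    intro v hv
    have hN : σ ⁻¹' 𝒱.V₁ ∩ σ ⁻¹' 𝒱.V₂ ∈ 𝓝 v :=
      ((𝒱.isOpen₁.preimage σ.continuous).inter (𝒱.isOpen₂.preimage σ.continuous)).mem_nhds hv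
    obtain ⟨N, ⟨hN1, hN2⟩, hN3⟩ := (path_connected_basis v).mem_iff.1 hN
    filter_upwards [hN1] with v' hv'
    obtain ⟨γ, hγ⟩ := hN2.joinedIn v (mem_of_mem_nhds hN1) v' hv'
    have h1 : σ v ∈ 𝒱.V₁ ∩ 𝒱.V₂ := hv
    have h2 : σ v' ∈ 𝒱.V₁ ∩ 𝒱.V₂ := hN3 hv'
    simp only [w, dif_pos h1, dif_pos h2]
    rw [← 𝒱.tail_trans _ _ h1 h2 (γ.map σ.continuous) fun t => hN3 (hγ t)]
    exact s.apply_trans_path γ _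
  obtain ⟨b₁, b₂, h₁, h₂, h₁₂⟩ := exists_locallyConst_sub (𝒱.isOpen₁.preimage σ.continuous)
    (𝒱.isOpen₂.preimage σ.continuous) (fun v => 𝒱.cover (σ v)) w hw
  exact ⟨b₁, b₂, h₁, h₂, fun v h => (h₁₂ v h).trans (dif_pos h)⟩

theorem IsPotential.potVal_sub [PreconnectedSpace T] {σ : C(T, X)} {s : FlatSection ρ σ}
    {b₁ b₂ b₁' b₂' : T → R} (h : 𝒱.IsPotential s b₁ b₂) (h' : 𝒱.IsPotential s b₁' b₂') (v w : T) :
    𝒱.potVal σ b₁ b₂ w - 𝒱.potVal σ b₁ b₂ v = 𝒱.potVal σ b₁' b₂' w - 𝒱.potVal σ b₁' b₂' v := by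
  let d : T → R := fun v => 𝒱.potVal σ b₁ b₂ v - 𝒱.potVal σ b₁' b₂' v
  have hd2 : ∀ v, σ v ∈ 𝒱.V₂ → d v = b₂ v - b₂' v := fun v hv => by simp [d, potVal, hv]
  have hd1 : ∀ v, σ v ∈ 𝒱.V₁ → d v = b₁ v - b₁' v := fun v hv => by
    by_cases hv2 : σ v ∈ 𝒱.V₂
    · have e := (h.sub_eq v ⟨hv, hv2⟩).trans (h'.sub_eq v ⟨hv, hv2⟩).symm
      rw [hd2 v hv2, sub_eq_sub_iff_sub_eq_sub, ← neg_sub (b₁ v), e, neg_sub]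
    · simp [d, potVal, hv2]
  have hd : IsLocallyConstant d := by
    rw [IsLocallyConstant.iff_eventually_eq]
    intro v
    rcases 𝒱.cover (σ v) with hv | hv
    · filter_upwards [h.locallyConst₁ v hv, h'.locallyConst₁ v hv,
        (𝒱.isOpen₁.preimage σ.continuous).mem_nhds hv] with v' e e' hv'
      rw [hd1 v hv, hd1 v' hv', e, e']
    · filter_upwards [h.locallyConst₂ v hv, h'.locallyConst₂ v hv,
        (𝒱.isOpen₂.preimage σ.continuous).mem_nhds hv] with v' e e' hv'
      rw [hd2 v hv, hd2 v' hv', e, e']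
  have := hd.apply_eq_of_preconnectedSpace v w
  simp only [d] at this
  rw [sub_eq_sub_iff_sub_eq_sub]
  exact this.symm

variable (𝒱) in
/-- The difference of the values at `w` and at `v` of the potentials of `s`. -/
noncomputable def jump [SimplyConnectedSpace T] [LocallyPathConnectedSpace T] {σ : C(T, X)}
    (v w : T) (s : FlatSection ρ σ) : R :=
  𝒱.potVal σ (exists_isPotential (𝒱 := 𝒱) s).choose
      (exists_isPotential (𝒱 := 𝒱) s).choose_spec.choose w -
    𝒱.potVal σ (exists_isPotential (𝒱 := 𝒱) s).choose
      (exists_isPotential (𝒱 := 𝒱) s).choose_spec.choose v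

section

variable [SimplyConnectedSpace T] [LocallyPathConnectedSpace T] {σ : C(T, X)}

theorem IsPotential.jump_eq {s : FlatSection ρ σ} {b₁ b₂ : T → R} (h : 𝒱.IsPotential s b₁ b₂)
    (v w : T) : 𝒱.jump v w s = 𝒱.potVal σ b₁ b₂ w - 𝒱.potVal σ b₁ b₂ v :=
  (exists_isPotential (𝒱 := 𝒱) s).choose_spec.choose_spec.potVal_sub h v w

theorem jump_add (v w : T) (s t : FlatSection ρ σ) :
    𝒱.jump v w (s + t) = 𝒱.jump v w s + 𝒱.jump v w t := by
  obtain ⟨b₁, b₂, h⟩ := exists_isPotential (𝒱 := 𝒱) s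
  obtain ⟨c₁, c₂, k⟩ := exists_isPotential (𝒱 := 𝒱) t
  have : 𝒱.IsPotential (s + t) (b₁ + c₁) (b₂ + c₂) := by
    refine ⟨fun v hv => ?_, fun v hv => ?_, fun v hv => ?_⟩
    · filter_upwards [h.locallyConst₁ v hv, k.locallyConst₁ v hv] with v' e e'
      simp [e, e']
    · filter_upwards [h.locallyConst₂ v hv, k.locallyConst₂ v hv] with v' e e'
      simp [e, e']
    · rw [FlatSection.add_val, ← h.sub_eq v hv, ← k.sub_eq v hv]
      simp only [Pi.add_apply]; abel
  rw [this.jump_eq, h.jump_eq, k.jump_eq]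
  simp only [potVal, Pi.add_apply]
  split_ifs <;> abel

theorem jump_smul (v w : T) (r : Rᵐᵒᵖ) (s : FlatSection ρ σ) :
    𝒱.jump v w (r • s) = r • 𝒱.jump v w s := by
  obtain ⟨b₁, b₂, h⟩ := exists_isPotential (𝒱 := 𝒱) s
  have : 𝒱.IsPotential (r • s) (r • b₁) (r • b₂) := by
    refine ⟨fun v hv => ?_, fun v hv => ?_, fun v hv => ?_⟩
    · filter_upwards [h.locallyConst₁ v hv] with v' e
      simp [e]
    · filter_upwards [h.locallyConst₂ v hv] with v' e
      simp [e]
    · rw [FlatSection.smul_val, ← h.sub_eq v hv]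
      simp [sub_mul]
  rw [this.jump_eq, h.jump_eq]
  simp only [potVal, Pi.smul_apply]
  split_ifs <;> simp [sub_mul]

theorem jump_add_jump (u v w : T) (s : FlatSection ρ σ) :
    𝒱.jump u v s + 𝒱.jump v w s = 𝒱.jump u w s := by
  simp only [jump]; abel

theorem jump_restrict [SimplyConnectedSpace T'] [LocallyPathConnectedSpace T'] (d : C(T', T))
    (v w : T') (s : FlatSection ρ σ) :
    𝒱.jump v w (FlatSection.restrict ρ σ d s) = 𝒱.jump (d v) (d w) s := by
  obtain ⟨b₁, b₂, h⟩ := exists_isPotential (𝒱 := 𝒱) s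
  have : 𝒱.IsPotential (FlatSection.restrict ρ σ d s) (b₁ ∘ d) (b₂ ∘ d) :=
    ⟨fun v hv => d.continuous.continuousAt.eventually (h.locallyConst₁ (d v) hv),
      fun v hv => d.continuous.continuousAt.eventually (h.locallyConst₂ (d v) hv),
      fun v hv => h.sub_eq (d v) hv⟩
  rw [this.jump_eq, h.jump_eq]
  rfl

/-- The jump vanishes on sections over maps into `V₂`. -/
theorem jump_eq_zero_of_mem {s : FlatSection ρ σ} (hσ : ∀ v, σ v ∈ 𝒱.V₂) (v w : T) :
    𝒱.jump v w s = 0 := by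
  classical
  have : 𝒱.IsPotential s (fun v => if h : σ v ∈ 𝒱.V₁ ∩ 𝒱.V₂ then s.1 v (𝒱.tail _ h) else 0) 0 := by
    refine ⟨fun v hv => ?_, fun v hv => ?_, fun v hv => ?_⟩
    · obtain ⟨b₁, b₂, h⟩ := exists_isPotential (𝒱 := 𝒱) s
      filter_upwards [h.locallyConst₁ v hv, h.locallyConst₂ v (hσ v),
        (𝒱.isOpen₁.preimage σ.continuous).mem_nhds hv] with v' e e' hv'
      rw [dif_pos ⟨hv', hσ v'⟩, dif_pos ⟨hv, hσ v⟩, ← h.sub_eq v' ⟨hv', hσ v'⟩,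
        ← h.sub_eq v ⟨hv, hσ v⟩, e, e']
    · simp
    · rw [dif_pos hv, Pi.zero_apply, sub_zero]
  rw [this.jump_eq]
  simp [potVal, hσ]

/-- The jump of a section over a map into `V₁` with endpoints in the intersection. -/
theorem jump_eq_of_mem {s : FlatSection ρ σ} (hσ : ∀ v, σ v ∈ 𝒱.V₁) (v w : T)
    (hv : σ v ∈ 𝒱.V₁ ∩ 𝒱.V₂) (hw : σ w ∈ 𝒱.V₁ ∩ 𝒱.V₂) :
    𝒱.jump v w s = s.1 v (𝒱.tail _ hv) - s.1 w (𝒱.tail _ hw) := by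
  classical
  have : 𝒱.IsPotential s 0
      (fun v => if h : σ v ∈ 𝒱.V₁ ∩ 𝒱.V₂ then - s.1 v (𝒱.tail _ h) else 0) := by
    refine ⟨fun v hv => ?_, fun v hv => ?_, fun v hv => ?_⟩
    · simp
    · obtain ⟨b₁, b₂, h⟩ := exists_isPotential (𝒱 := 𝒱) s
      filter_upwards [h.locallyConst₁ v (hσ v), h.locallyConst₂ v hv,
        (𝒱.isOpen₂.preimage σ.continuous).mem_nhds hv] with v' e e' hv'
      rw [dif_pos ⟨hσ v', hv'⟩, dif_pos ⟨hσ v, hv⟩, ← h.sub_eq v' ⟨hσ v', hv'⟩,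
        ← h.sub_eq v ⟨hσ v, hv⟩, e, e']
    · rw [dif_pos hv, Pi.zero_apply, zero_sub, neg_neg]
  rw [this.jump_eq]
  simp only [potVal, if_pos hv.2, if_pos hw.2, dif_pos hv, dif_pos hw]
  abel

end

variable (ρ 𝒱) in
open Classical in
/-- The functional on `1`-chains that induces the boundary map `H₁(X; R) → R` of the
Mayer–Vietoris sequence, the target being `H₀` of the intersection. -/
noncomputable def functional : LocalChains ρ 1 →ₗ[Rᵐᵒᵖ] R :=
  DirectSum.toModule Rᵐᵒᵖ _ _ fun _ =>
    { toFun := 𝒱.jump (stdSimplex.vertex 0) (stdSimplex.vertex 1)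
      map_add' := jump_add _ _
      map_smul' := jump_smul _ _ }

open Classical in
theorem functional_lof (σ : C(stdSimplex ℝ (Fin 2), X)) (s : FlatSection ρ σ) :
    functional ρ 𝒱 (DirectSum.lof Rᵐᵒᵖ (C(stdSimplex ℝ (Fin 2), X)) (fun τ => FlatSection ρ τ) σ s)
      = 𝒱.jump (stdSimplex.vertex 0) (stdSimplex.vertex 1) s := by
  simp only [functional]
  rw [DirectSum.toModule_lof]
  rfl

theorem functional_boundary (c : LocalChains ρ 2) : functional ρ 𝒱 (localBoundary ρ 1 c) = 0 := by
  classical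
  suffices h : functional ρ 𝒱 ∘ₗ localBoundary ρ 1 = 0 from LinearMap.congr_fun h c
  apply DirectSum.linearMap_ext
  intro σ
  ext s
  have key : ∀ i : Fin 3, functional ρ 𝒱 (DirectSum.lof Rᵐᵒᵖ (C(stdSimplex ℝ (Fin 2), X))
      (fun τ => FlatSection ρ τ) (σ.comp (faceMap 1 i)) (FlatSection.restrict ρ σ (faceMap 1 i) s))
      = 𝒱.jump (stdSimplex.vertex (i.succAbove 0)) (stdSimplex.vertex (i.succAbove 1)) s := by
    intro i
    rw [functional_lof, jump_restrict, faceMap_vertex, faceMap_vertex]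
  simp only [localBoundary, LinearMap.comp_apply, LinearMap.zero_apply]
  rw [DirectSum.toModule_lof]
  simp only [LinearMap.sum_apply, LinearMap.smul_apply, map_sum, map_zsmul, LinearMap.comp_apply]
  rw [Fin.sum_univ_three, key, key, key]
  have := jump_add_jump (𝒱 := 𝒱) (stdSimplex.vertex 0) (stdSimplex.vertex 1) (stdSimplex.vertex 2) s
  simp [Fin.succAbove]
  rw [← this]
  abel

end CutCover

end MayerVietoris

/-! ### One-dimensional chains along paths -/

section FaceCoordinates

theorem faceMap_succAbove (k : ℕ) (i : Fin (k + 2)) (v : stdSimplex ℝ (Fin (k + 1)))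
    (j : Fin (k + 1)) : faceMap k i v (i.succAbove j) = v j := by
  change FunOnFinite.linearMap ℝ ℝ i.succAbove v (i.succAbove j) = _
  rw [FunOnFinite.linearMap_apply_apply, Finset.sum_eq_single j]
  · intro b hb hbj
    exact absurd (Fin.succAbove_right_injective (Finset.mem_filter.1 hb).2) hbj
  · simp

theorem faceMap_self (k : ℕ) (i : Fin (k + 2)) (v : stdSimplex ℝ (Fin (k + 1))) :
    faceMap k i v i = 0 := by
  change FunOnFinite.linearMap ℝ ℝ i.succAbove v i = _
  rw [FunOnFinite.linearMap_apply_apply]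
  refine Finset.sum_eq_zero fun b hb => ?_
  exact absurd (Finset.mem_filter.1 hb).2 (Fin.succAbove_ne i b)

theorem continuous_coord (k : ℕ) (i : Fin (k + 1)) :
    Continuous fun v : stdSimplex ℝ (Fin (k + 1)) => v i :=
  (continuous_apply i).comp continuous_subtype_val

end FaceCoordinates

section Edges

open scoped DirectSum

variable {X : Type u} [TopologicalSpace X] {x₀ : X} {R : Type u} [Ring R]
  {ρ : FundamentalGroup X x₀ →* R} {T T' : Type} [TopologicalSpace T] [TopologicalSpace T']

namespace FlatSection

/-- The value of a flat section over `σ` at a path to the point `x = σ v`. The equality `x = σ v`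
need not be definitional. -/
def val {σ : C(T, X)} (s : FlatSection ρ σ) {v : T} {x : X} (h : σ v = x)
    (p : Path.Homotopic.Quotient x₀ x) : R :=
  s.1 v (p.cast rfl h)

theorem val_rfl {σ : C(T, X)} (s : FlatSection ρ σ) (v : T)
    (p : Path.Homotopic.Quotient x₀ (σ v)) : s.val rfl p = s.1 v p := by
  simp [val]

theorem val_add {σ : C(T, X)} (s t : FlatSection ρ σ) {v : T} {x : X} (h : σ v = x)
    (p : Path.Homotopic.Quotient x₀ x) : (s + t).val h p = s.val h p + t.val h p := rfl

theorem val_smul {σ : C(T, X)} (a : Rᵐᵒᵖ) (s : FlatSection ρ σ) {v : T} {x : X} (h : σ v = x)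
    (p : Path.Homotopic.Quotient x₀ x) : (a • s).val h p = s.val h p * a.unop := rfl

theorem val_restrict {σ : C(T, X)} (s : FlatSection ρ σ) (d : C(T', T)) {v : T'} {w : T} {x : X}
    (h : σ.comp d v = x) (hw : d v = w) (h' : σ w = x) (p : Path.Homotopic.Quotient x₀ x) :
    (restrict ρ σ d s).val h p = s.val h' p := by
  subst hw; rfl

theorem val_mul {σ : C(T, X)} (s : FlatSection ρ σ) {v : T} {x : X} (h : σ v = x)
    (g : FundamentalGroup X x₀) (p : Path.Homotopic.Quotient x₀ x) :
    ρ g * s.val h (g.toPath.trans p) = s.val h p := by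
  subst h
  simpa only [val_rfl] using s.map_mul_apply g p

theorem val_trans {σ : C(T, X)} (s : FlatSection ρ σ) {v w : T} {x y : X} (γ : Path v w)
    (P : Path x y) (hP : ∀ t, σ (γ t) = P t) (hv : σ v = x) (hw : σ w = y)
    (p : Path.Homotopic.Quotient x₀ x) : s.val hw (p.trans (.mk P)) = s.val hv p := by
  subst hv hw
  obtain rfl : P = γ.map σ.continuous := by ext t; exact (hP t).symm
  simpa only [val_rfl] using s.apply_trans_path γ p

theorem val_ext [PathConnectedSpace T] {σ : C(T, X)} {s t : FlatSection ρ σ} {v : T} {x : X}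
    (h : σ v = x) (p : Path.Homotopic.Quotient x₀ x) (hst : s.val h p = t.val h p) : s = t :=
  ext_of_apply v _ hst

end FlatSection

variable (ρ) in
/-- The flat section over `σ` with the value `r` at the path `p` to the point `x = σ v`. -/
noncomputable def sectionAt [SimplyConnectedSpace T] (σ : C(T, X)) {v : T} {x : X} (h : σ v = x)
    (p : Path.Homotopic.Quotient x₀ x) (r : R) : FlatSection ρ σ :=
  FlatSection.ofValue ρ σ v (p.cast rfl h) r

theorem sectionAt_val [SimplyConnectedSpace T] (σ : C(T, X)) {v : T} {x : X} (h : σ v = x)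
    (p : Path.Homotopic.Quotient x₀ x) (r : R) : (sectionAt ρ σ h p r).val h p = r :=
  FlatSection.ofValue_apply _ _ _ _

open Classical in
/-- The chain `(σ, s)`. -/
noncomputable def chain {k : ℕ} (σ : C(stdSimplex ℝ (Fin (k + 1)), X)) (s : FlatSection ρ σ) :
    LocalChains ρ k :=
  DirectSum.lof Rᵐᵒᵖ (C(stdSimplex ℝ (Fin (k + 1)), X)) (fun τ => FlatSection ρ τ) σ s

open Classical in
variable (ρ) in
/-- The linear map on chains with prescribed values on the chains `(σ, s)`. -/
noncomputable def chainLift {k : ℕ} {N : Type*} [AddCommGroup N] [Module Rᵐᵒᵖ N]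
    (φ : ∀ σ : C(stdSimplex ℝ (Fin (k + 1)), X), FlatSection ρ σ →ₗ[Rᵐᵒᵖ] N) :
    LocalChains ρ k →ₗ[Rᵐᵒᵖ] N :=
  DirectSum.toModule Rᵐᵒᵖ _ _ φ

theorem chainLift_chain {k : ℕ} {N : Type*} [AddCommGroup N] [Module Rᵐᵒᵖ N]
    (φ : ∀ σ : C(stdSimplex ℝ (Fin (k + 1)), X), FlatSection ρ σ →ₗ[Rᵐᵒᵖ] N)
    (σ : C(stdSimplex ℝ (Fin (k + 1)), X)) (s : FlatSection ρ σ) :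
    chainLift ρ φ (chain σ s) = φ σ s := by
  classical
  exact DirectSum.toModule_lof (φ := φ) Rᵐᵒᵖ σ s

theorem chain_add {k : ℕ} (σ : C(stdSimplex ℝ (Fin (k + 1)), X)) (s t : FlatSection ρ σ) :
    chain σ (s + t) = chain σ s + chain σ t := by simp [chain]

theorem chain_smul {k : ℕ} (σ : C(stdSimplex ℝ (Fin (k + 1)), X)) (a : Rᵐᵒᵖ) (s : FlatSection ρ σ) :
    chain σ (a • s) = a • chain σ s := by simp [chain]

theorem chain_eq {k : ℕ} {σ σ' : C(stdSimplex ℝ (Fin (k + 1)), X)} (hσ : σ = σ')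
    (s : FlatSection ρ σ) (s' : FlatSection ρ σ') {v : stdSimplex ℝ (Fin (k + 1))} {x : X}
    (h : σ v = x) (h' : σ' v = x) (p : Path.Homotopic.Quotient x₀ x) (hs : s.val h p = s'.val h' p) :
    chain σ s = chain σ' s' := by
  subst hσ
  rw [FlatSection.val_ext h p hs]

theorem localBoundary_chain {k : ℕ} (σ : C(stdSimplex ℝ (Fin (k + 1 + 1)), X))
    (s : FlatSection ρ σ) :
    localBoundary ρ k (chain σ s) = ∑ i : Fin (k + 2), (-1 : ℤ) ^ (i : ℕ) •
      chain (σ.comp (faceMap k i)) (FlatSection.restrict ρ σ (faceMap k i) s) := by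
  classical
  simp only [localBoundary, chain]
  rw [DirectSum.toModule_lof]
  simp

theorem localBoundary_chain_one (σ : C(stdSimplex ℝ (Fin (0 + 1 + 1)), X)) (s : FlatSection ρ σ) :
    localBoundary ρ 0 (chain σ s) =
      chain (σ.comp (faceMap 0 0)) (FlatSection.restrict ρ σ (faceMap 0 0) s) -
      chain (σ.comp (faceMap 0 1)) (FlatSection.restrict ρ σ (faceMap 0 1) s) := by
  rw [localBoundary_chain, Fin.sum_univ_two]
  simp [sub_eq_add_neg]

/-- The singular `1`-simplex of a path. -/
noncomputable def edge {x y : X} (P : Path x y) : C(stdSimplex ℝ (Fin 2), X) :=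
  ⟨fun v => P.extend (v 1), P.continuous_extend.comp (continuous_coord 1 1)⟩

theorem edge_apply {x y : X} (P : Path x y) (v : stdSimplex ℝ (Fin 2)) :
    edge P v = P.extend (v 1) := rfl

theorem edge_zero {x y : X} (P : Path x y) : edge P (stdSimplex.vertex 0) = x := by
  simp [edge_apply]

theorem edge_one {x y : X} (P : Path x y) : edge P (stdSimplex.vertex 1) = y := by
  simp [edge_apply]

/-- The path along the `1`-simplex. -/
noncomputable def simplexPath :
    Path (stdSimplex.vertex 0 : stdSimplex ℝ (Fin 2)) (stdSimplex.vertex 1) where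
  toFun := stdSimplexHomeomorphUnitInterval.symm
  continuous_toFun := stdSimplexHomeomorphUnitInterval.symm.continuous
  source' := by rw [Homeomorph.symm_apply_eq]; rfl
  target' := by rw [Homeomorph.symm_apply_eq]; rfl

theorem simplexPath_apply_one (t : unitInterval) : simplexPath t 1 = t := rfl

theorem edge_simplexPath {x y : X} (P : Path x y) (t : unitInterval) :
    edge P (simplexPath t) = P t := by
  rw [edge_apply, simplexPath_apply_one, Path.extend_apply P t.2]

theorem edge_map_simplexPath (σ : C(stdSimplex ℝ (Fin 2), X)) :
    edge (simplexPath.map σ.continuous) = σ := by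
  ext v
  have hv : v 1 ∈ Set.Icc (0 : ℝ) 1 := ⟨stdSimplex.zero_le v 1, stdSimplex.le_one v 1⟩
  rw [edge_apply, Path.extend_apply _ hv]
  exact congrArg σ (stdSimplexHomeomorphUnitInterval.symm_apply_apply v)

/-- The value of a flat section along an edge is transported by the path. -/
theorem edge_val_trans {x y : X} (P : Path x y) (s : FlatSection ρ (edge P))
    (p : Path.Homotopic.Quotient x₀ x) :
    s.val (edge_one P) (p.trans (.mk P)) = s.val (edge_zero P) p :=
  s.val_trans simplexPath P (edge_simplexPath P) _ _ p

variable (ρ) in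
/-- The class, modulo boundaries, of the chain carried by the path `P` from `x` to `y`, with the
coefficient whose value at the path `p` from `x₀` to `x` is `r`. -/
noncomputable def edgeClass {x y : X} (P : Path x y) (p : Path.Homotopic.Quotient x₀ x) (r : R) :
    LocalChains ρ 1 ⧸ LinearMap.range (localBoundary ρ 1) :=
  Submodule.Quotient.mk (chain (edge P) (sectionAt ρ (edge P) (edge_zero P) p r))

theorem mk_chain_eq_edgeClass {x y : X} {P : Path x y} {σ : C(stdSimplex ℝ (Fin 2), X)}
    (hσ : ∀ v, σ v = P.extend (v 1)) (s : FlatSection ρ σ) (h : σ (stdSimplex.vertex 0) = x)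
    (p : Path.Homotopic.Quotient x₀ x) {r : R} (hr : s.val h p = r) :
    (Submodule.Quotient.mk (chain σ s) : LocalChains ρ 1 ⧸ LinearMap.range (localBoundary ρ 1)) =
      edgeClass ρ P p r := by
  unfold edgeClass
  congr 1
  exact chain_eq (ContinuousMap.ext hσ) s _ h (edge_zero P) p (hr.trans (sectionAt_val _ _ _ _).symm)

theorem edgeClass_add {x y : X} (P : Path x y) (p : Path.Homotopic.Quotient x₀ x) (r r' : R) :
    edgeClass ρ P p (r + r') = edgeClass ρ P p r + edgeClass ρ P p r' := by
  simp only [edgeClass, sectionAt, FlatSection.ofValue_add, chain_add, Submodule.Quotient.mk_add]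

theorem edgeClass_zero {x y : X} (P : Path x y) (p : Path.Homotopic.Quotient x₀ x) :
    edgeClass ρ P p 0 = 0 := by
  simpa using edgeClass_add (ρ := ρ) P p 0 0

theorem edgeClass_smul {x y : X} (P : Path x y) (p : Path.Homotopic.Quotient x₀ x) (r : R)
    (a : Rᵐᵒᵖ) : a • edgeClass ρ P p r = edgeClass ρ P p (r * a.unop) := by
  simp only [edgeClass, sectionAt, ← FlatSection.ofValue_smul, chain_smul,
    Submodule.Quotient.mk_smul]

theorem edgeClass_mul {x y : X} (P : Path x y) (g : FundamentalGroup X x₀)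
    (p : Path.Homotopic.Quotient x₀ x) (r : R) :
    edgeClass ρ P (g.toPath.trans p) r = edgeClass ρ P p (ρ g * r) := by
  refine mk_chain_eq_edgeClass (fun v => rfl) _ (edge_zero P) p ?_
  rw [← FlatSection.val_mul _ _ g p, sectionAt_val]

/-- The relation among the classes of the three edges of a singular triangle. -/
theorem edgeClass_triangle {x y z : X} {P : Path x y} {Q : Path y z} {S : Path x z}
    (F : C(stdSimplex ℝ (Fin 3), X)) (hP : ∀ v, F (faceMap 1 2 v) = P.extend (v 1))
    (hQ : ∀ v, F (faceMap 1 0 v) = Q.extend (v 1)) (hS : ∀ v, F (faceMap 1 1 v) = S.extend (v 1))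
    (p : Path.Homotopic.Quotient x₀ x) (r : R) :
    edgeClass ρ S p r = edgeClass ρ P p r + edgeClass ρ Q (p.trans (.mk P)) r := by
  have e20 : faceMap 1 2 (stdSimplex.vertex 0) = stdSimplex.vertex 0 := faceMap_vertex 1 2 0
  have e21 : faceMap 1 2 (stdSimplex.vertex 1) = stdSimplex.vertex 1 := faceMap_vertex 1 2 1
  have e10 : faceMap 1 1 (stdSimplex.vertex 0) = stdSimplex.vertex 0 := faceMap_vertex 1 1 0
  have e00 : faceMap 1 0 (stdSimplex.vertex 0) = stdSimplex.vertex 1 := faceMap_vertex 1 0 0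
  have hx : F (stdSimplex.vertex 0) = x := by rw [← e20, hP]; simp
  have hy : F (stdSimplex.vertex 1) = y := by rw [← e21, hP]; simp
  let s := sectionAt ρ F hx p r
  have hs : s.val hy (p.trans (.mk P)) = r := by
    rw [s.val_trans ((simplexPath.map (faceMap 1 2).continuous).cast e20.symm e21.symm) P
      (fun t => (hP _).trans (by rw [simplexPath_apply_one, Path.extend_apply P t.2])) hx hy]
    exact sectionAt_val _ _ _ _
  have key : (Submodule.Quotient.mk (localBoundary ρ 1 (chain F s)) :
      LocalChains ρ 1 ⧸ LinearMap.range (localBoundary ρ 1)) = 0 := by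
    rw [Submodule.Quotient.mk_eq_zero]
    exact ⟨_, rfl⟩
  rw [localBoundary_chain, Fin.sum_univ_three] at key
  simp only [Submodule.Quotient.mk_add, Submodule.Quotient.mk_smul] at key
  rw [mk_chain_eq_edgeClass (P := P) (σ := F.comp (faceMap 1 2)) hP _
      (by rw [ContinuousMap.comp_apply, e20, hx]) p
      ((s.val_restrict _ _ e20 hx p).trans (sectionAt_val _ _ _ _)),
    mk_chain_eq_edgeClass (P := S) (σ := F.comp (faceMap 1 1)) hS _
      (by rw [ContinuousMap.comp_apply, e10, hx]) p
      ((s.val_restrict _ _ e10 hx p).trans (sectionAt_val _ _ _ _)),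
    mk_chain_eq_edgeClass (P := Q) (σ := F.comp (faceMap 1 0)) hQ _
      (by rw [ContinuousMap.comp_apply, e00, hy]) (p.trans (.mk P))
      ((s.val_restrict _ _ e00 hy _).trans hs)] at key
  simp at key
  exact (sub_eq_zero.1 (Eq.trans (by abel) key)).symm

theorem edgeClass_refl (x : X) (p : Path.Homotopic.Quotient x₀ x) (r : R) :
    edgeClass ρ (Path.refl x) p r = 0 := by
  have h := edgeClass_triangle (ρ := ρ) (P := Path.refl x) (Q := Path.refl x) (S := Path.refl x)
    (.const _ x) (by simp) (by simp) (by simp) p r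
  rw [Path.Homotopic.Quotient.mk_refl, Path.Homotopic.Quotient.trans_refl] at h
  simpa using h

theorem edgeClass_trans {x y z : X} (P : Path x y) (Q : Path y z)
    (p : Path.Homotopic.Quotient x₀ x) (r : R) :
    edgeClass ρ (P.trans Q) p r = edgeClass ρ P p r + edgeClass ρ Q (p.trans (.mk P)) r := by
  refine edgeClass_triangle ⟨fun a => (P.trans Q).extend (a 2 + a 1 / 2),
    (P.trans Q).continuous_extend.comp
      ((continuous_coord 2 2).add ((continuous_coord 2 1).div_const 2))⟩ ?_ ?_ ?_ p r
  all_goals intro v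
  all_goals have h0 := stdSimplex.zero_le v 0
  all_goals have h1 := stdSimplex.zero_le v 1
  all_goals have h2 := stdSimplex.add_eq_one v
  · have e1 : faceMap 1 2 v 1 = v 1 := faceMap_succAbove 1 2 v 1
    have e2 : faceMap 1 2 v 2 = 0 := faceMap_self 1 2 v
    change (P.trans Q).extend (faceMap 1 2 v 2 + faceMap 1 2 v 1 / 2) = _
    rw [e1, e2, Path.extend_trans_of_le_half _ _ (by linarith)]
    congr 1; ring
  · have e1 : faceMap 1 0 v 1 = v 0 := faceMap_succAbove 1 0 v 0
    have e2 : faceMap 1 0 v 2 = v 1 := faceMap_succAbove 1 0 v 1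
    change (P.trans Q).extend (faceMap 1 0 v 2 + faceMap 1 0 v 1 / 2) = _
    rw [e1, e2, Path.extend_trans_of_half_le _ _ (by linarith)]
    congr 1; linarith
  · have e1 : faceMap 1 1 v 1 = 0 := faceMap_self 1 1 v
    have e2 : faceMap 1 1 v 2 = v 1 := faceMap_succAbove 1 1 v 1
    change (P.trans Q).extend (faceMap 1 1 v 2 + faceMap 1 1 v 1 / 2) = _
    rw [e1, e2]
    congr 1; ring

/-- The class of an edge depends only on the homotopy class of the path: the square of a homotopy is
cut along its diagonal. -/
theorem edgeClass_homotopic {x y : X} {P Q : Path x y} (h : P.Homotopic Q)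
    (p : Path.Homotopic.Quotient x₀ x) (r : R) : edgeClass ρ P p r = edgeClass ρ Q p r := by
  obtain ⟨H⟩ := h
  let π : ℝ → unitInterval := Set.projIcc 0 1 zero_le_one
  have hπ : Continuous π := continuous_projIcc
  let D : Path x y :=
    { toFun := fun t => H (t, t)
      continuous_toFun := H.continuous.comp (continuous_id.prodMk continuous_id)
      source' := H.source 0
      target' := H.target 1 }
  have hπ0 : π 0 = 0 := Set.projIcc_left _
  have hπ1 : π 1 = 1 := Set.projIcc_right _
  have hD : ∀ t, D.extend t = H (π t, π t) := fun t => rfl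
  have hP : ∀ t, P.extend t = H (0, π t) := fun t => (H.apply_zero _).symm
  have hQ : ∀ t, Q.extend t = H (1, π t) := fun t => (H.apply_one _).symm
  have t1 := edgeClass_triangle (ρ := ρ) (P := P) (Q := Path.refl y) (S := D)
    ⟨fun a => H (π (a 2), π (a 1 + a 2)), H.continuous.comp
      ((hπ.comp (continuous_coord 2 2)).prodMk
        (hπ.comp ((continuous_coord 2 1).add (continuous_coord 2 2))))⟩
    (fun v => by
      have e1 : faceMap 1 2 v 1 = v 1 := faceMap_succAbove 1 2 v 1
      have e2 : faceMap 1 2 v 2 = 0 := faceMap_self 1 2 v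
      change H (π (faceMap 1 2 v 2), π (faceMap 1 2 v 1 + faceMap 1 2 v 2)) = _
      rw [e1, e2, hP, hπ0, add_zero])
    (fun v => by
      have e1 : faceMap 1 0 v 1 = v 0 := faceMap_succAbove 1 0 v 0
      have e2 : faceMap 1 0 v 2 = v 1 := faceMap_succAbove 1 0 v 1
      change H (π (faceMap 1 0 v 2), π (faceMap 1 0 v 1 + faceMap 1 0 v 2)) = _
      rw [e1, e2, stdSimplex.add_eq_one, hπ1, Path.Homotopy.target]; simp)
    (fun v => by
      have e1 : faceMap 1 1 v 1 = 0 := faceMap_self 1 1 v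
      have e2 : faceMap 1 1 v 2 = v 1 := faceMap_succAbove 1 1 v 1
      change H (π (faceMap 1 1 v 2), π (faceMap 1 1 v 1 + faceMap 1 1 v 2)) = _
      rw [e1, e2, hD, zero_add]) p r
  have t2 := edgeClass_triangle (ρ := ρ) (P := Path.refl x) (Q := Q) (S := D)
    ⟨fun a => H (π (a 1 + a 2), π (a 2)), H.continuous.comp
      ((hπ.comp ((continuous_coord 2 1).add (continuous_coord 2 2))).prodMk
        (hπ.comp (continuous_coord 2 2)))⟩
    (fun v => by
      have e1 : faceMap 1 2 v 1 = v 1 := faceMap_succAbove 1 2 v 1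
      have e2 : faceMap 1 2 v 2 = 0 := faceMap_self 1 2 v
      change H (π (faceMap 1 2 v 1 + faceMap 1 2 v 2), π (faceMap 1 2 v 2)) = _
      rw [e2, hπ0, Path.Homotopy.source]; simp)
    (fun v => by
      have e1 : faceMap 1 0 v 1 = v 0 := faceMap_succAbove 1 0 v 0
      have e2 : faceMap 1 0 v 2 = v 1 := faceMap_succAbove 1 0 v 1
      change H (π (faceMap 1 0 v 1 + faceMap 1 0 v 2), π (faceMap 1 0 v 2)) = _
      rw [e1, e2, hQ, stdSimplex.add_eq_one, hπ1])
    (fun v => by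
      have e1 : faceMap 1 1 v 1 = 0 := faceMap_self 1 1 v
      have e2 : faceMap 1 1 v 2 = v 1 := faceMap_succAbove 1 1 v 1
      change H (π (faceMap 1 1 v 1 + faceMap 1 1 v 2), π (faceMap 1 1 v 2)) = _
      rw [e1, e2, hD, zero_add]) p r
  rw [edgeClass_refl, add_zero] at t1
  rw [edgeClass_refl, zero_add, Path.Homotopic.Quotient.mk_refl,
    Path.Homotopic.Quotient.trans_refl] at t2
  rw [← t1, t2]

end Edges

/-! ### Vanishing of `H₁` for a cyclic fundamental group -/

section Vanishing

open scoped DirectSum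

variable {X : Type u} [TopologicalSpace X] {x₀ : X} {R : Type u} [Ring R]
  (ρ : FundamentalGroup X x₀ →* R)

/-- The functional on `0`-chains that reads off the coefficients along chosen paths from `x₀`. -/
noncomputable def readOff (q : ∀ x : X, Path.Homotopic.Quotient x₀ x) :
    LocalChains ρ 0 →ₗ[Rᵐᵒᵖ] R :=
  chainLift ρ fun _ =>
    { toFun := fun s => s.val (v := stdSimplex.vertex 0) rfl (q _)
      map_add' := fun s t => s.val_add t rfl _
      map_smul' := fun a s => s.val_smul a rfl _ }

theorem readOff_chain (q : ∀ x : X, Path.Homotopic.Quotient x₀ x)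
    (σ : C(stdSimplex ℝ (Fin 1), X)) (s : FlatSection ρ σ) {x : X}
    (h : σ (stdSimplex.vertex 0) = x) : readOff ρ q (chain σ s) = s.val h (q x) := by
  subst h
  exact chainLift_chain _ σ s

theorem faceMap_zero_zero_vertex :
    faceMap 0 0 (stdSimplex.vertex 0) = stdSimplex.vertex 1 := faceMap_vertex 0 0 0

theorem faceMap_zero_one_vertex :
    faceMap 0 1 (stdSimplex.vertex 0) = stdSimplex.vertex 0 := faceMap_vertex 0 1 0

theorem readOff_boundary_chain (q : ∀ x : X, Path.Homotopic.Quotient x₀ x)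
    (σ : C(stdSimplex ℝ (Fin (0 + 1 + 1)), X)) (s : FlatSection ρ σ) {x y : X}
    (hx : σ (stdSimplex.vertex 0) = x) (hy : σ (stdSimplex.vertex 1) = y) :
    readOff ρ q (localBoundary ρ 0 (chain σ s)) = s.val hy (q y) - s.val hx (q x) := by
  have h0 : σ.comp (faceMap 0 0) (stdSimplex.vertex 0) = y := by
    rw [ContinuousMap.comp_apply, faceMap_zero_zero_vertex, hy]
  have h1 : σ.comp (faceMap 0 1) (stdSimplex.vertex 0) = x := by
    rw [ContinuousMap.comp_apply, faceMap_zero_one_vertex, hx]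
  rw [localBoundary_chain_one, map_sub, readOff_chain ρ q _ _ h0, readOff_chain ρ q _ _ h1,
    s.val_restrict _ _ faceMap_zero_zero_vertex hy, s.val_restrict _ _ faceMap_zero_one_vertex hx]

theorem readOff_boundary_boundary (q : ∀ x : X, Path.Homotopic.Quotient x₀ x)
    (c : LocalChains ρ 2) : readOff ρ q (localBoundary ρ 0 (localBoundary ρ 1 c)) = 0 := by
  classical
  suffices h : readOff ρ q ∘ₗ localBoundary ρ 0 ∘ₗ localBoundary ρ 1 = 0 from
    LinearMap.congr_fun h c
  apply DirectSum.linearMap_ext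
  intro σ
  ext s
  change readOff ρ q (localBoundary ρ 0 (localBoundary ρ 1 (chain σ s))) = 0
  let n : Fin 3 → R := fun j => s.val (v := stdSimplex.vertex j) rfl (q _)
  have key : ∀ i : Fin 3, readOff ρ q (localBoundary ρ 0 (chain (σ.comp (faceMap 1 i))
      (FlatSection.restrict ρ σ (faceMap 1 i) s))) = n (i.succAbove 1) - n (i.succAbove 0) := by
    intro i
    have h : ∀ j, σ.comp (faceMap 1 i) (stdSimplex.vertex j) =
        σ (stdSimplex.vertex (i.succAbove j)) := fun j => by
      rw [ContinuousMap.comp_apply, faceMap_vertex]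
    rw [readOff_boundary_chain ρ q _ _ (h 0) (h 1),
      s.val_restrict _ _ (faceMap_vertex 1 i 1) rfl, s.val_restrict _ _ (faceMap_vertex 1 i 0) rfl]
  rw [localBoundary_chain]
  simp only [map_sum, map_zsmul, key]
  rw [Fin.sum_univ_three]
  simp [Fin.succAbove]

theorem edgeClass_toPath {y : X} (P : Path x₀ y) (g : FundamentalGroup X x₀) (r : R) :
    edgeClass ρ P g.toPath r = edgeClass ρ P (.refl x₀) (ρ g * r) := by
  rw [← edgeClass_mul, Path.Homotopic.Quotient.trans_refl]

/-- If `x` generates the fundamental group, the classes of loops are multiples of that of `x`. -/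
theorem exists_edgeClass_loop {x : FundamentalGroup X x₀} (hx : ∀ g, g ∈ Subgroup.zpowers x)
    {P : Path x₀ x₀} (hP : .mk P = x.toPath) (L : Path x₀ x₀) (r : R) :
    ∃ r', edgeClass ρ L (.refl x₀) r = edgeClass ρ P (.refl x₀) r' := by
  let e : Path.Homotopic.Quotient x₀ x₀ := .refl x₀
  let H : Subgroup (FundamentalGroup X x₀) :=
    { carrier := {g | ∀ L : Path x₀ x₀, .fromPath (.mk L) = g →
        ∀ r, ∃ r', edgeClass ρ L e r = edgeClass ρ P e r'}
      one_mem' := by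
        intro L hL r
        refine ⟨0, ?_⟩
        have : L.Homotopic (Path.refl x₀) := Path.Homotopic.Quotient.eq.1 hL
        rw [edgeClass_homotopic this, edgeClass_refl, edgeClass_zero]
      mul_mem' := by
        intro g h hg hh L hL r
        obtain ⟨A, hA⟩ := Path.Homotopic.Quotient.mk_surjective h.toPath
        obtain ⟨B, hB⟩ := Path.Homotopic.Quotient.mk_surjective g.toPath
        have : L.Homotopic (A.trans B) := by
          rw [← Path.Homotopic.Quotient.eq, Path.Homotopic.Quotient.mk_trans, hA, hB]
          exact hL
        rw [edgeClass_homotopic this, edgeClass_trans, Path.Homotopic.Quotient.refl_trans, hA,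
          edgeClass_toPath ρ B h]
        obtain ⟨r₁, h₁⟩ := hh A hA r
        obtain ⟨r₂, h₂⟩ := hg B hB (ρ h * r)
        exact ⟨r₁ + r₂, by rw [h₁, h₂, edgeClass_add]⟩
      inv_mem' := by
        intro g hg L hL r
        obtain ⟨A, hA⟩ := Path.Homotopic.Quotient.mk_surjective g.toPath
        have h1 : (A.trans L).Homotopic (Path.refl x₀) := by
          rw [← Path.Homotopic.Quotient.eq, Path.Homotopic.Quotient.mk_trans, hA]
          have : (Path.Homotopic.Quotient.mk L) = (g⁻¹).toPath := hL
          rw [this]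
          change ((g⁻¹ * g).toPath) = _
          rw [inv_mul_cancel]; rfl
        have h2 := edgeClass_homotopic (ρ := ρ) h1 e (ρ g⁻¹ * r)
        rw [edgeClass_refl, edgeClass_trans, Path.Homotopic.Quotient.refl_trans, hA, edgeClass_toPath ρ L g,
          ← mul_assoc, ← map_mul, mul_inv_cancel, map_one, one_mul] at h2
        obtain ⟨r', h'⟩ := hg A hA (-(ρ g⁻¹ * r))
        refine ⟨r', ?_⟩
        rw [← h', ← add_right_inj (edgeClass ρ A e (ρ g⁻¹ * r)), h2, ← edgeClass_add,
          add_neg_cancel, edgeClass_zero] }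
  have hxH : x ∈ H := by
    intro L hL r
    have : L.Homotopic P := by
      rw [← Path.Homotopic.Quotient.eq, hP]; exact hL
    exact ⟨r, by rw [edgeClass_homotopic this]⟩
  exact (Subgroup.zpowers_le.2 hxH) (hx (.fromPath (.mk L))) L rfl r

/-- Every chain differs from a chain carried by a generator `x` of the fundamental group by a
boundary and a chain that depends linearly on its boundary only. In particular every cycle is
homologous to a chain carried by `x`. -/
theorem exists_mk_eq_edgeClass [PathConnectedSpace X] {x : FundamentalGroup X x₀}
    (hx : ∀ g, g ∈ Subgroup.zpowers x) {P : Path x₀ x₀} (hP : .mk P = x.toPath)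
    {z : LocalChains ρ 1} (hz0 : localBoundary ρ 0 z = 0) :
    ∃ r, (Submodule.Quotient.mk z : LocalChains ρ 1 ⧸ LinearMap.range (localBoundary ρ 1)) =
      edgeClass ρ P (.refl x₀) r := by
  classical
  let Q := LocalChains ρ 1 ⧸ LinearMap.range (localBoundary ρ 1)
  let pth : ∀ y : X, Path x₀ y := fun y => PathConnectedSpace.somePath x₀ y
  let q : ∀ y : X, Path.Homotopic.Quotient x₀ y := fun y => .mk (pth y)
  let e : Path.Homotopic.Quotient x₀ x₀ := .refl x₀
  let A : LocalChains ρ 0 →ₗ[Rᵐᵒᵖ] Q := chainLift ρ fun σ =>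
    { toFun := fun s => edgeClass ρ (pth (σ (stdSimplex.vertex 0))) e
        (s.val (v := stdSimplex.vertex 0) rfl (q _))
      map_add' := fun s t => edgeClass_add _ _ _ _
      map_smul' := fun a s => (edgeClass_smul _ _ _ a).symm }
  have hA : ∀ (σ : C(stdSimplex ℝ (Fin 1), X)) (s : FlatSection ρ σ) {y : X}
      (h : σ (stdSimplex.vertex 0) = y), A (chain σ s) = edgeClass ρ (pth y) e (s.val h (q y)) := by
    intro σ s y h
    subst h
    exact chainLift_chain _ σ s
  have hz : ∀ z : LocalChains ρ 1, ∃ r, (Submodule.Quotient.mk z : Q) - A (localBoundary ρ 0 z) =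
      edgeClass ρ P e r := by
    intro z
    induction z using DirectSum.induction_on with
    | zero =>
      exact ⟨0, by simp [edgeClass_zero]⟩
    | add z w hz hw =>
      obtain ⟨r, hr⟩ := hz
      obtain ⟨r', hr'⟩ := hw
      refine ⟨r + r', ?_⟩
      rw [edgeClass_add, ← hr, ← hr', map_add, map_add, Submodule.Quotient.mk_add]
      abel
    | of σ s =>
      change ∃ r, (Submodule.Quotient.mk (chain σ s) : Q) - A (localBoundary ρ 0 (chain σ s)) = _
      let S : Path (σ (stdSimplex.vertex 0)) (σ (stdSimplex.vertex 1)) :=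
        simplexPath.map σ.continuous
      let y := σ (stdSimplex.vertex 0)
      let z := σ (stdSimplex.vertex 1)
      let r := s.val (v := stdSimplex.vertex 0) rfl (q y)
      obtain ⟨L, hLdef⟩ : ∃ L : Path x₀ x₀, L = ((pth y).trans S).trans (pth z).symm := ⟨_, rfl⟩
      let g : FundamentalGroup X x₀ := .fromPath (.mk L)
      have hL : (L.trans (pth z)).Homotopic ((pth y).trans S) := by
        rw [← Path.Homotopic.Quotient.eq]
        simp [hLdef, Path.Homotopic.Quotient.mk_trans, Path.Homotopic.Quotient.mk_symm]
      have hz : s.val (v := stdSimplex.vertex 1) rfl (q z) = ρ g * r := by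
        have h1 : s.val (v := stdSimplex.vertex 1) rfl ((q y).trans (.mk S)) = r :=
          s.val_trans simplexPath S (fun _ => rfl) rfl rfl (q y)
        have h2 : g.toPath.trans (q z) = (q y).trans (.mk S) := by
          have := Path.Homotopic.Quotient.eq.2 hL
          rwa [Path.Homotopic.Quotient.mk_trans, Path.Homotopic.Quotient.mk_trans] at this
        rw [← s.val_mul rfl g (q z), h2, h1]
      have hmk : (Submodule.Quotient.mk (chain σ s) : Q) = edgeClass ρ S (q y) r :=
        mk_chain_eq_edgeClass (fun v => by
          conv_lhs => rw [← edge_map_simplexPath σ]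
          rfl) s rfl (q y) rfl
      have hrel := edgeClass_homotopic (ρ := ρ) hL e r
      rw [edgeClass_trans, edgeClass_trans, Path.Homotopic.Quotient.refl_trans,
        Path.Homotopic.Quotient.refl_trans] at hrel
      have hbd : A (localBoundary ρ 0 (chain σ s)) =
          edgeClass ρ (pth z) e (ρ g * r) - edgeClass ρ (pth y) e r := by
        have h0 : σ.comp (faceMap 0 0) (stdSimplex.vertex 0) = z := by
          rw [ContinuousMap.comp_apply, faceMap_zero_zero_vertex]
        have h1 : σ.comp (faceMap 0 1) (stdSimplex.vertex 0) = y := by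
          rw [ContinuousMap.comp_apply, faceMap_zero_one_vertex]
        rw [localBoundary_chain_one, map_sub, hA _ _ h0, hA _ _ h1,
          s.val_restrict _ _ faceMap_zero_zero_vertex rfl,
          s.val_restrict _ _ faceMap_zero_one_vertex rfl, hz]
      obtain ⟨r', hr'⟩ := exists_edgeClass_loop ρ hx hP L r
      refine ⟨r', ?_⟩
      rw [← hr', hmk, hbd, ← edgeClass_toPath ρ (pth z) g r]
      have h3 : edgeClass ρ S (q y) r = edgeClass ρ L e r + edgeClass ρ (pth z) g.toPath r -
          edgeClass ρ (pth y) e r := (eq_sub_of_add_eq' hrel.symm)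
      rw [h3]
      abel
  obtain ⟨r, hr⟩ := hz z
  exact ⟨r, by rwa [hz0, map_zero, sub_zero] at hr⟩

/-- The first homology with local coefficients vanishes if the fundamental group is generated by one
element `x` and `ρ x - 1` is left regular. The class of a cycle is a sum of classes of loops, hence
the class of the generator with one coefficient `r`, and the boundary of this chain
is `(ρ x - 1) r`. -/
theorem subsingleton_localH1_of_cyclic [PathConnectedSpace X] (x : FundamentalGroup X x₀)
    (hx : ∀ g, g ∈ Subgroup.zpowers x) (hreg : ∀ r : R, (ρ x - 1) * r = 0 → r = 0) :
    Subsingleton (LocalH1 ρ) := by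
  let e : Path.Homotopic.Quotient x₀ x₀ := .refl x₀
  let q : ∀ y : X, Path.Homotopic.Quotient x₀ y := fun y => .mk (PathConnectedSpace.somePath x₀ y)
  obtain ⟨P, hP⟩ := Path.Homotopic.Quotient.mk_surjective x.toPath
  refine ⟨fun a b => ?_⟩
  have hzero : ∀ a : LocalH1 ρ, a = 0 := by
    intro a
    obtain ⟨⟨z, hz0⟩, rfl⟩ := Submodule.Quotient.mk_surjective _ a
    rw [Submodule.Quotient.mk_eq_zero]
    change z ∈ LinearMap.range (localBoundary ρ 1)
    have hz0' : localBoundary ρ 0 z = 0 := hz0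
    obtain ⟨r, hr⟩ := exists_mk_eq_edgeClass ρ hx hP hz0'
    suffices h : r = 0 by
      rw [h] at hr
      rw [edgeClass_zero] at hr
      exact (Submodule.Quotient.mk_eq_zero _).1 hr
    obtain ⟨c, hc⟩ := (Submodule.Quotient.eq _).1 hr
    have h1 := readOff_boundary_boundary ρ q c
    rw [hc, map_sub, hz0', map_sub, map_zero, zero_sub, neg_eq_zero,
      readOff_boundary_chain ρ q _ _ (edge_zero P) (edge_one P)] at h1
    set s := sectionAt ρ (edge P) (edge_zero P) e r
    let l : FundamentalGroup X x₀ := .fromPath (q x₀)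
    have hs0 : s.val (edge_zero P) e = r := sectionAt_val _ _ _ _
    have hs1 : s.val (edge_one P) e = ρ x * r := by
      have h2 := edge_val_trans P s e
      rw [Path.Homotopic.Quotient.refl_trans, hP, hs0] at h2
      rw [← s.val_mul (edge_one P) x e, Path.Homotopic.Quotient.trans_refl, h2]
    have hl : ∀ {v} (h : edge P v = x₀), ρ l * s.val h (q x₀) = s.val h e := by
      intro v h
      rw [← s.val_mul h l e, Path.Homotopic.Quotient.trans_refl]
    apply hreg
    rw [sub_mul, one_mul, ← hs1, ← hs0, ← hl, ← hl, ← mul_sub, h1, mul_zero]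
  rw [hzero a, hzero b]

end Vanishing

/-! ### Homology classes detected by the functional -/

section Detection

open scoped DirectSum

variable {X : Type u} [TopologicalSpace X] {x₀ : X} {R : Type u} [Ring R]
  (ρ : FundamentalGroup X x₀ →* R)

/-- The chain at a single point whose coefficient has the value `r` at `q`. -/
noncomputable def pointChain {x : X} (q : Path.Homotopic.Quotient x₀ x) : R →+ LocalChains ρ 0 :=
  AddMonoidHom.mk' (fun r => chain (.const _ x) (sectionAt ρ (.const _ x)
    (v := stdSimplex.vertex 0) rfl q r)) fun r r' => by
      simp only [sectionAt, FlatSection.ofValue_add, chain_add]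

theorem chain_eq_pointChain {x : X} (q : Path.Homotopic.Quotient x₀ x)
    (σ : C(stdSimplex ℝ (Fin 1), X)) (s : FlatSection ρ σ) (h : σ (stdSimplex.vertex 0) = x) :
    chain σ s = pointChain ρ q (s.val h q) := by
  have hσ : σ = .const _ x := by
    ext v
    rw [Subsingleton.elim v (stdSimplex.vertex 0), h]
    rfl
  exact chain_eq hσ s _ h rfl q (sectionAt_val _ _ _ _).symm

theorem localBoundary_edge_loop {x : X} (γ : Path x x) (q : Path.Homotopic.Quotient x₀ x) (r : R) :
    localBoundary ρ 0 (chain (edge γ) (sectionAt ρ (edge γ) (edge_zero γ) q r)) =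
      pointChain ρ q ((ρ (loopOf (q.trans (.mk γ)) q) - 1) * r) := by
  set s := sectionAt ρ (edge γ) (edge_zero γ) q r
  have hs0 : s.val (edge_zero γ) q = r := sectionAt_val _ _ _ _
  have hs1 : s.val (edge_one γ) q = ρ (loopOf (q.trans (.mk γ)) q) * r := by
    rw [← s.val_mul (edge_one γ) (loopOf (q.trans (.mk γ)) q) q, loopOf_trans, edge_val_trans, hs0]
  have h0 : (edge γ).comp (faceMap 0 0) (stdSimplex.vertex 0) = x := by
    rw [ContinuousMap.comp_apply, faceMap_zero_zero_vertex, edge_one]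
  have h1 : (edge γ).comp (faceMap 0 1) (stdSimplex.vertex 0) = x := by
    rw [ContinuousMap.comp_apply, faceMap_zero_one_vertex, edge_zero]
  rw [localBoundary_chain_one, chain_eq_pointChain ρ q _ _ h0, chain_eq_pointChain ρ q _ _ h1,
    s.val_restrict _ _ faceMap_zero_zero_vertex (edge_one γ),
    s.val_restrict _ _ faceMap_zero_one_vertex (edge_zero γ), hs0, hs1, ← map_sub, sub_mul, one_mul]

namespace CutCover

variable (𝒱 : CutCover x₀)

theorem functional_chain (σ : C(stdSimplex ℝ (Fin 2), X)) (s : FlatSection ρ σ) :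
    functional ρ 𝒱 (chain σ s) = 𝒱.jump (stdSimplex.vertex 0) (stdSimplex.vertex 1) s :=
  functional_lof σ s

theorem edge_mem {x y : X} {γ : Path x y} {V : Set X} (hγ : ∀ t, γ t ∈ V)
    (v : stdSimplex ℝ (Fin 2)) : edge γ v ∈ V := by
  rw [edge_apply, Path.extend_apply _ ⟨stdSimplex.zero_le v 1, stdSimplex.le_one v 1⟩]
  exact hγ _

theorem functional_edge₁ {x : X} (hx : x ∈ 𝒱.V₁ ∩ 𝒱.V₂) (γ : Path x x) (hγ : ∀ t, γ t ∈ 𝒱.V₁)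
    (r : R) : functional ρ 𝒱 (chain (edge γ) (sectionAt ρ (edge γ) (edge_zero γ) (𝒱.tail x hx) r)) =
      -((ρ (loopOf ((𝒱.tail x hx).trans (.mk γ)) (𝒱.tail x hx)) - 1) * r) := by
  have htail : ∀ {y : X} (h : y = x) (hy : y ∈ 𝒱.V₁ ∩ 𝒱.V₂),
      𝒱.tail y hy = (𝒱.tail x hx).cast rfl h := by
    intro y h hy; subst h; simp
  rw [functional_chain, jump_eq_of_mem (edge_mem hγ) _ _ (by rwa [edge_zero]) (by rwa [edge_one]),
    htail (edge_zero γ), htail (edge_one γ)]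
  set q := 𝒱.tail x hx
  set s := sectionAt ρ (edge γ) (edge_zero γ) q r
  have hs0 : s.val (edge_zero γ) q = r := sectionAt_val _ _ _ _
  have hs1 : s.val (edge_one γ) q = ρ (loopOf (q.trans (.mk γ)) q) * r := by
    rw [← s.val_mul (edge_one γ) (loopOf (q.trans (.mk γ)) q) q, loopOf_trans, edge_val_trans, hs0]
  change s.val (edge_zero γ) q - s.val (edge_one γ) q = _
  rw [hs0, hs1, sub_mul, one_mul, neg_sub]

theorem functional_edge₂ {x : X} (hx : x ∈ 𝒱.V₁ ∩ 𝒱.V₂) (γ : Path x x) (hγ : ∀ t, γ t ∈ 𝒱.V₂)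
    (r : R) :
    functional ρ 𝒱 (chain (edge γ) (sectionAt ρ (edge γ) (edge_zero γ) (𝒱.tail x hx) r)) = 0 := by
  rw [functional_chain, jump_eq_zero_of_mem (edge_mem hγ)]

/-- Two loops `γ₁` in `V₁` and `γ₂` in `V₂` with coefficients `r₁` and `r₂` such that
`(ρ g₁ - 1) r₁ = (ρ g₂ - 1) r₂` form a cycle, and this common value is recovered from its homology
class. -/
theorem exists_functional_localH1 {x : X} (hx : x ∈ 𝒱.V₁ ∩ 𝒱.V₂) (γ₁ γ₂ : Path x x)
    (h₁ : ∀ t, γ₁ t ∈ 𝒱.V₁) (h₂ : ∀ t, γ₂ t ∈ 𝒱.V₂) {g₁ g₂ : FundamentalGroup X x₀}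
    (hg₁ : g₁ = loopOf ((𝒱.tail x hx).trans (.mk γ₁)) (𝒱.tail x hx))
    (hg₂ : g₂ = loopOf ((𝒱.tail x hx).trans (.mk γ₂)) (𝒱.tail x hx)) :
    ∃ Φ : LocalH1 ρ →ₗ[Rᵐᵒᵖ] R, ∀ r₁ r₂ : R, (ρ g₁ - 1) * r₁ = (ρ g₂ - 1) * r₂ →
      ∃ c, Φ c = (ρ g₁ - 1) * r₁ := by
  subst hg₁ hg₂
  let Φ : LocalH1 ρ →ₗ[Rᵐᵒᵖ] R := Submodule.liftQ _
    (-(functional ρ 𝒱) ∘ₗ (LinearMap.ker (localBoundary ρ 0)).subtype) (by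
      rintro ⟨z, hz⟩ ⟨c, hc⟩
      change localBoundary ρ 1 c = z at hc
      change -functional ρ 𝒱 z = 0
      rw [← hc, functional_boundary, neg_zero])
  refine ⟨Φ, fun r₁ r₂ hr => ?_⟩
  let z := chain (edge γ₁) (sectionAt ρ (edge γ₁) (edge_zero γ₁) (𝒱.tail x hx) r₁) -
    chain (edge γ₂) (sectionAt ρ (edge γ₂) (edge_zero γ₂) (𝒱.tail x hx) r₂)
  have hz : localBoundary ρ 0 z = 0 := by
    simp only [z, map_sub]
    rw [localBoundary_edge_loop, localBoundary_edge_loop, hr, sub_self]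
  refine ⟨Submodule.Quotient.mk ⟨z, hz⟩, ?_⟩
  change -functional ρ 𝒱 z = _
  simp only [z, map_sub]
  rw [functional_edge₁ ρ 𝒱 hx γ₁ h₁, functional_edge₂ ρ 𝒱 hx γ₂ h₂, sub_zero, neg_neg]

end CutCover

end Detection

/-! ### The coefficient ring -/

section CoefficientRing

variable {G : Type u} [Group G] (ψ : G →* Multiplicative ℤ) (n : ℕ)

theorem denomS_le_nonZeroDivisors : denomS ψ n ≤ (MonoidAlgebra ℤ (Gam G n))⁰ := by
  rintro _ ⟨s, hs, rfl⟩
  rw [SetLike.mem_coe, mem_nonZeroDivisors_iff_ne_zero] at hs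
  rw [mem_nonZeroDivisors_iff_ne_zero]
  exact (map_ne_zero_iff (groupRingIncl (GamBar ψ n)) (groupRingIncl_injective _)).2 hs

instance nontrivial_ringR : Nontrivial (ringR ψ n) :=
  OreLocalization.nontrivial_of_nonZeroDivisors (denomS_le_nonZeroDivisors ψ n)

/-- The canonical homomorphism `ℤ[Γ_n] → R_n`. -/
noncomputable def toRingR : MonoidAlgebra ℤ (Gam G n) →+* ringR ψ n :=
  OreLocalization.numeratorRingHom (S := denomS ψ n)

theorem toRingR_injective : Function.Injective (toRingR ψ n) :=
  OreLocalization.numeratorHom_inj fun _ hx =>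
    (mem_nonZeroDivisors_iff.1 (denomS_le_nonZeroDivisors ψ n hx)).1

variable {ψ n} in
/-- Nonzero elements of the domain `ℤ[Γ_n]` stay regular in `R_n`, as the Ore condition moves them past
the denominators. -/
theorem toRingR_mul_eq_zero {a : MonoidAlgebra ℤ (Gam G n)} (ha : a ≠ 0) {r : ringR ψ n}
    (h : toRingR ψ n a * r = 0) : r = 0 := by
  induction r using OreLocalization.ind with | _ b s
  obtain ⟨v, w, hvw⟩ : ∃ (v : MonoidAlgebra ℤ (Gam G n)) (w : denomS ψ n),
      (w : MonoidAlgebra ℤ (Gam G n)) * a = v * s :=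
    ⟨_, _, OreLocalization.ore_eq a s⟩
  have h1 : toRingR ψ n a * (b /ₒ s) = (v * b) /ₒ (w * 1) :=
    OreLocalization.oreDiv_mul_char a b 1 s v w hvw
  have hmul : ∀ (x : MonoidAlgebra ℤ (Gam G n)) (t : denomS ψ n),
      toRingR ψ n t * (x /ₒ t) = toRingR ψ n x := fun x t => OreLocalization.mul_cancel
  have h2 : v * b = 0 := by
    apply toRingR_injective ψ n
    rw [← hmul (v * b) (w * 1), ← h1, h, mul_zero, map_zero]
  have hw : (w : MonoidAlgebra ℤ (Gam G n)) ≠ 0 :=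
    mem_nonZeroDivisors_iff_ne_zero.1 (denomS_le_nonZeroDivisors ψ n w.2)
  have hv : v ≠ 0 := by
    rintro rfl
    rw [zero_mul] at hvw
    exact (mul_ne_zero hw ha) hvw
  rw [(mul_eq_zero.1 h2).resolve_left hv]
  exact OreLocalization.zero_oreDiv s

theorem coeffHom_apply (g : G) :
    coeffHom ψ n g = toRingR ψ n (MonoidAlgebra.single (g : Gam G n) 1) := rfl

/-- If some homomorphism to `ℤ` does not vanish on `x`, then `x - 1` is regular in `R_n`. -/
theorem coeffHom_sub_one_mul_eq_zero {x : G} (ψ' : G →* Multiplicative ℤ) (hx : ψ' x ≠ 1)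
    {r : ringR ψ n} (h : (coeffHom ψ n x - 1) * r = 0) : r = 0 := by
  rw [coeffHom_apply, ← map_one (toRingR ψ n), ← map_sub] at h
  refine toRingR_mul_eq_zero ?_ h
  rw [sub_ne_zero, MonoidAlgebra.one_def]
  intro h1
  have h2 : (x : Gam G n) = 1 := MonoidAlgebra.single_left_injective one_ne_zero h1
  exact hx (rationalDerived_le_ker ψ' n ((QuotientGroup.eq_one_iff x).1 h2))

/-- The homomorphism `R_n → R_n[z, z⁻¹]` that records the grading of `R_n` by `ψ`: it multiplies
`g` by `z ^ ψ(g)` and fixes `𝕂_n`. -/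
theorem exists_gradingHom : ∃ Θ : ringR ψ n →+* MonoidAlgebra (ringR ψ n) (Multiplicative ℤ),
    (∀ g, Θ (coeffHom ψ n g) = MonoidAlgebra.single (ψ g) (coeffHom ψ n g)) ∧
    ∀ y, Θ (skewKToRingR ψ n y) = MonoidAlgebra.single 1 (skewKToRingR ψ n y) := by
  let A := MonoidAlgebra (ringR ψ n) (Multiplicative ℤ)
  let F : Gam G n →* A :=
    { toFun := fun γ => MonoidAlgebra.single (psiBar ψ n γ) (toRingR ψ n (MonoidAlgebra.single γ 1))
      map_one' := by rw [map_one, ← MonoidAlgebra.one_def, map_one, MonoidAlgebra.one_def]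
      map_mul' := fun a b => by
        rw [MonoidAlgebra.single_mul_single, ← map_mul, ← map_mul, MonoidAlgebra.single_mul_single,
          one_mul] }
  let f : MonoidAlgebra ℤ (Gam G n) →+* A := (MonoidAlgebra.lift ℤ A (Gam G n) F).toRingHom
  have hf1 : ∀ γ, f (MonoidAlgebra.single γ 1) =
      MonoidAlgebra.single (psiBar ψ n γ) (toRingR ψ n (MonoidAlgebra.single γ 1)) := fun γ => by
    change MonoidAlgebra.lift ℤ A (Gam G n) F (MonoidAlgebra.single γ 1) = _
    rw [MonoidAlgebra.lift_single, one_smul]; rfl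
  have hf2 : ∀ y : MonoidAlgebra ℤ (GamBar ψ n), f (groupRingIncl (GamBar ψ n) y) =
      MonoidAlgebra.singleOneRingHom (toRingR ψ n (groupRingIncl (GamBar ψ n) y)) := by
    intro y
    suffices h : f.comp (groupRingIncl (GamBar ψ n)) = (MonoidAlgebra.singleOneRingHom.comp
        (toRingR ψ n)).comp (groupRingIncl (GamBar ψ n)) from RingHom.congr_fun h y
    refine MonoidAlgebra.ringHom_ext (fun m => ?_) fun g => ?_
    · have : (MonoidAlgebra.single 1 m : MonoidAlgebra ℤ (GamBar ψ n)) = (m : ℤ) :=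
        (MonoidAlgebra.intCast_def m).symm
      rw [this, map_intCast, map_intCast]
    · have : groupRingIncl (GamBar ψ n) (MonoidAlgebra.single g 1) =
          MonoidAlgebra.single (g : Gam G n) 1 := by simp
      simp only [RingHom.comp_apply, this]
      rw [hf1, show psiBar ψ n g = 1 from g.2]
      rfl
  have hunit : ∀ s : denomS ψ n, IsUnit (f s) := by
    rintro ⟨_, s, hs, rfl⟩
    rw [hf2]
    exact (OreLocalization.numerator_isUnit (⟨_, s, hs, rfl⟩ : denomS ψ n)).map
      MonoidAlgebra.singleOneRingHom
  let Θ : ringR ψ n →+* A := OreLocalization.universalHom f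
    (IsUnit.liftRight (f.toMonoidHom.comp (denomS ψ n).subtype) hunit) (fun _ => rfl)
  have hΘ : ∀ x, Θ (toRingR ψ n x) = f x := fun x => OreLocalization.universalHom_commutes _ _ _
  have hK : ∀ x, skewKToRingR ψ n (OreLocalization.numeratorHom x) =
      toRingR ψ n (groupRingIncl (GamBar ψ n) x) := fun x =>
    OreLocalization.universalHom_commutes _ _ _
  refine ⟨Θ, fun g => ?_, fun y => ?_⟩
  · rw [coeffHom_apply, hΘ, hf1]; rfl
  · change _ = MonoidAlgebra.singleOneRingHom _
    induction y using OreLocalization.ind with | _ a s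
    have h1 : (OreLocalization.numeratorHom (s : MonoidAlgebra ℤ (GamBar ψ n)) : skewK ψ n) *
        (a /ₒ s) = OreLocalization.numeratorHom a := OreLocalization.mul_cancel
    have h2 := congrArg (skewKToRingR ψ n) h1
    rw [map_mul, hK, hK] at h2
    have h3 := congrArg Θ h2
    have h4 := congrArg (MonoidAlgebra.singleOneRingHom (M := Multiplicative ℤ)) h2
    rw [map_mul, hΘ, hΘ, hf2, hf2] at h3
    rw [map_mul, ← h3] at h4
    refine (IsUnit.mul_left_cancel ?_ h4).symm
    exact (OreLocalization.numerator_isUnit (⟨_, s, s.2, rfl⟩ : denomS ψ n)).map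
      MonoidAlgebra.singleOneRingHom

variable {ψ n}

/-- The element of `𝕂_n` defined by an element of the kernel of `ψ`. -/
theorem exists_skewK_eq_coeffHom {k : G} (hk : ψ k = 1) :
    ∃ y : skewK ψ n, skewKToRingR ψ n y = coeffHom ψ n k ∧ y ≠ 0 ∧
      (coeffHom ψ n k ≠ 1 → 1 - y ≠ 0) := by
  let k' : GamBar ψ n := ⟨(k : Gam G n), hk⟩
  have h1 : skewKToRingR ψ n (OreLocalization.numeratorHom (MonoidAlgebra.single k' 1)) =
      coeffHom ψ n k := by
    rw [coeffHom_apply]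
    refine (OreLocalization.universalHom_commutes _ _ _).trans ?_
    have : groupRingIncl (GamBar ψ n) (MonoidAlgebra.single k' 1) =
        MonoidAlgebra.single (k : Gam G n) 1 := by simp [k']
    exact congrArg (toRingR ψ n) this
  refine ⟨_, h1, ?_, ?_⟩
  · intro h0
    rw [h0, map_zero] at h1
    exact (isUnit_map_group (coeffHom ψ n) k).ne_zero h1.symm
  · intro hne h0
    rw [sub_eq_zero] at h0
    rw [← h0, map_one] at h1
    exact hne h1.symm

/-- The right ideals generated by `g₁ - 1` and `g₂ - 1` have a common element of degree two, if `g₁`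
and `g₂` have the same image in `ℤ`. In the notation of skew Laurent polynomials with `t = g₁` and
`g₂ = t k`, it is `(t - 1) (t a + b) = (t k - 1) (t + b)` where `t a = k t`
and `(1 - k) b = a - 1`. -/
theorem exists_common_multiple {g₁ g₂ : G} (h : ψ g₁ = ψ g₂) :
    ∃ (r₁ r₂ : ringR ψ n) (α β γ : skewK ψ n), α ≠ 0 ∧
      (coeffHom ψ n g₁ - 1) * r₁ = (coeffHom ψ n g₂ - 1) * r₂ ∧
      (coeffHom ψ n g₁ - 1) * r₁ = coeffHom ψ n (g₁ ^ 2) * skewKToRingR ψ n α +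
        coeffHom ψ n g₁ * skewKToRingR ψ n β + skewKToRingR ψ n γ := by
  set ρ := coeffHom ψ n
  set κ := skewKToRingR ψ n
  have hk : ψ (g₁⁻¹ * g₂) = 1 := by rw [map_mul, map_inv, h, inv_mul_cancel]
  have ha : ψ (g₁⁻¹ * (g₁⁻¹ * g₂) * g₁) = 1 := by rw [map_mul, map_mul, hk]; simp
  obtain ⟨y, hy, -, hy1⟩ := exists_skewK_eq_coeffHom (n := n) hk
  obtain ⟨α, hα, hα0, -⟩ := exists_skewK_eq_coeffHom (n := n) ha
  change κ y = ρ _ at hy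
  change κ α = ρ _ at hα
  set t := ρ g₁
  have hg₂ : ρ g₂ = t * κ y := by rw [hy, ← map_mul, mul_inv_cancel_left]
  have htα : t * κ α = κ y * t := by
    rw [hα, hy, ← map_mul, ← map_mul]; congr 1; group
  -- `1 - k` is invertible unless `g₁` and `g₂` agree in `R_n`.
  by_cases hne : ρ (g₁⁻¹ * g₂) = 1
  · refine ⟨t, t, 1, -1, 0, one_ne_zero, ?_, ?_⟩
    · rw [hg₂, hy, hne, mul_one]
    · have e : t * κ (-1) = -t := by rw [map_neg, map_one]; exact mul_neg_one t
      rw [pow_two, map_mul, map_one, map_zero, mul_one, add_zero, e, sub_mul, one_mul]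
      exact sub_eq_add_neg _ _
  · have hinv : (1 - y) * ((1 - y)⁻¹ * (α - 1)) = α - 1 := mul_inv_cancel_left₀ (hy1 hne) _
    set b := (1 - y)⁻¹ * (α - 1)
    have hb : κ b - κ y * κ b = κ α - 1 := by
      rw [← map_one κ, ← map_sub, ← hinv]; simp [sub_mul]
    refine ⟨t * κ α + κ b, t + κ b, α, b - α, -b, hα0, ?_, ?_⟩
    · rw [hg₂]
      have e1 : (t - 1) * (t * κ α + κ b) - (t * κ y - 1) * (t + κ b) =
          t * (t * κ α - κ y * t) + t * ((κ b - κ y * κ b) - κ α + 1) := by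
        simp only [mul_sub, sub_mul, mul_add, mul_one, one_mul, mul_assoc]
        abel
      rw [← sub_eq_zero, e1, htα, hb]
      simp
    · simp only [map_sub, map_neg, pow_two, map_mul, show ρ g₁ = t from rfl, mul_sub, sub_mul,
        mul_add, one_mul, mul_assoc]
      abel

/-- Multiplying a degree two element on the right by the powers of `t³` spreads it over disjoint
ranges of degrees, so that the products are linearly independent over `𝕂_n`. -/
theorem eq_zero_of_sum_eq_zero {g : G} (hg : ψ g ≠ 1) {α β γ : skewK ψ n} (hα : α ≠ 0)
    (s : Finset ℕ) (l : ℕ → skewK ψ n)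
    (h : ∑ j ∈ s, (coeffHom ψ n (g ^ 2) * skewKToRingR ψ n α + coeffHom ψ n g * skewKToRingR ψ n β +
      skewKToRingR ψ n γ) * coeffHom ψ n (g ^ (3 * j)) * skewKToRingR ψ n (l j) = 0) :
    ∀ j ∈ s, l j = 0 := by
  intro i hi
  obtain ⟨Θ, h1, h2⟩ := exists_gradingHom ψ n
  have hd : Function.Injective fun m : ℕ => ψ g ^ m := IsMulTorsionFree.pow_right_injective hg
  have h3 := congrArg (fun x => (Θ x).coeff (ψ g ^ (3 * i + 2))) h
  simp only [map_sum, map_mul, map_add, h1, h2, map_zero, MonoidAlgebra.coeff_zero,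
    MonoidAlgebra.coeff_sum, Finsupp.finsetSum_apply, add_mul, MonoidAlgebra.coeff_add,
    Finsupp.add_apply, MonoidAlgebra.single_pow, MonoidAlgebra.single_mul_single, mul_one, MonoidAlgebra.coeff_single,
    Finsupp.coe_zero, Pi.zero_apply, one_mul, map_pow, ← pow_add, ← pow_succ'] at h3
  rw [Finset.sum_eq_single i] at h3
  · rw [add_comm 2 (3 * i), Finsupp.single_eq_same, Finsupp.single_eq_of_ne,
      Finsupp.single_eq_of_ne, add_zero, add_zero] at h3
    · have hu : IsUnit (coeffHom ψ n g ^ 2 * skewKToRingR ψ n α * coeffHom ψ n g ^ (3 * i)) :=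
        ((isUnit_map_group _ g).pow _ |>.mul ((IsUnit.mk0 α hα).map _)).mul
          ((isUnit_map_group _ g).pow _)
      rw [hu.mul_right_eq_zero] at h3
      exact (map_eq_zero (skewKToRingR ψ n)).1 h3
    · intro e; have := hd e; omega
    · intro e; have := hd e; omega
  · intro j _ hj
    rw [Finsupp.single_eq_of_ne, Finsupp.single_eq_of_ne, Finsupp.single_eq_of_ne, add_zero, add_zero]
    all_goals intro e; have := hd e; omega
  · exact fun h => absurd hi h

/-- A right `R_n`-module with a linear functional that takes every common value of `(g₁ - 1) r₁`
and `(g₂ - 1) r₂` has infinite rank over `𝕂_n`. -/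
theorem toENat_rank_eq_top {H : Type u} [AddCommGroup H] [Module (ringR ψ n)ᵐᵒᵖ H] {g₁ g₂ : G}
    (h : ψ g₁ = ψ g₂) (h1 : ψ g₁ ≠ 1) (Φ : H →ₗ[(ringR ψ n)ᵐᵒᵖ] ringR ψ n)
    (hΦ : ∀ r₁ r₂ : ringR ψ n, (coeffHom ψ n g₁ - 1) * r₁ = (coeffHom ψ n g₂ - 1) * r₂ →
      ∃ c, Φ c = (coeffHom ψ n g₁ - 1) * r₁) :
    letI : Module (skewK ψ n)ᵐᵒᵖ H := Module.compHom _ (RingHom.op (skewKToRingR ψ n))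
    Cardinal.toENat (Module.rank (skewK ψ n)ᵐᵒᵖ H) = ⊤ := by
  let _ : Module (skewK ψ n)ᵐᵒᵖ H := Module.compHom _ (RingHom.op (skewKToRingR ψ n))
  let _ : Module (skewK ψ n)ᵐᵒᵖ (ringR ψ n) := Module.compHom _ (RingHom.op (skewKToRingR ψ n))
  obtain ⟨r₁, r₂, α, β, γ, hα, h12, he⟩ := exists_common_multiple (n := n) h
  have hc : ∀ j : ℕ, ∃ c, Φ c = (coeffHom ψ n g₁ - 1) * (r₁ * coeffHom ψ n (g₁ ^ (3 * j))) :=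
    fun j => hΦ _ (r₂ * coeffHom ψ n (g₁ ^ (3 * j))) (by rw [← mul_assoc, h12, mul_assoc])
  choose c hc using hc
  let Φ' : H →ₗ[(skewK ψ n)ᵐᵒᵖ] ringR ψ n :=
    { toFun := Φ
      map_add' := Φ.map_add
      map_smul' := fun a x => Φ.map_smul (RingHom.op (skewKToRingR ψ n) a) x }
  have hli : LinearIndependent (skewK ψ n)ᵐᵒᵖ c := by
    refine LinearIndependent.of_comp Φ' ?_
    rw [linearIndependent_iff']
    intro s l hl i hi
    apply MulOpposite.unop_injective
    refine eq_zero_of_sum_eq_zero h1 (β := β) (γ := γ) hα s (fun j => (l j).unop) ?_ i hi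
    rw [← he, ← hl]
    refine Finset.sum_congr rfl fun j _ => ?_
    change _ = Φ (c j) * skewKToRingR ψ n (l j).unop
    rw [hc, ← mul_assoc]
  exact Cardinal.toENat_eq_top.2 hli.aleph0_le_rank

end CoefficientRing

/-! ### Winding numbers -/

section Winding

open Complex

/-- The winding number of `F ∘ γ`, for a loop `γ` that is conjugated to the base point. -/
theorem windingHom_map_loopOf {X : Type*} [TopologicalSpace X] {x₀ x : X}
    (F : C(X, {z : ℂ // z ≠ 0})) (q : Path.Homotopic.Quotient x₀ x) (γ : Path x x)
    (θ : C(unitInterval, ℂ)) (hθ : ∀ t, exp (θ t) = F (γ t)) :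
    θ 1 - θ 0 = (windingHom (F x₀) (FundamentalGroup.map F x₀
      (loopOf (q.trans (.mk γ)) q))).toAdd * (2 * Real.pi * I) := by
  induction q using Path.Homotopic.Quotient.ind with | mk p
  let cov := isAddQuotientCoveringMap_exp.isCoveringMap
  -- Lift `F ∘ p⁻¹` to `ℂ`, starting at the value of `θ` at the common point.
  have h0 : (p.symm.map F.continuous) 0 =
      (fun z : ℂ => (⟨_, z.exp_ne_zero⟩ : {z : ℂ // z ≠ 0})) (θ 0) := by
    apply Subtype.ext
    have := hθ 0
    simp_all
  let l : C(unitInterval, ℂ) := cov.liftPath (p.symm.map F.continuous) (θ 0) h0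
  have hl0 : l 0 = θ 0 := cov.liftPath_zero ..
  have hl : ∀ t, exp (l t) = F (p.symm t) := fun t =>
    congrArg Subtype.val (congrFun (cov.liftPath_lifts (p.symm.map F.continuous) (θ 0) h0) t)
  have hper : exp (θ 1 - θ 0) = 1 := by
    rw [exp_sub, hθ, hθ, γ.source, γ.target, div_self (F x).2]
  let Λ : Path (θ 0) (l 1) := ⟨l, hl0, rfl⟩
  let B : Path (θ 0) (θ 1) := ⟨θ, rfl, rfl⟩
  let Λ' : Path (θ 1) (l 1 + (θ 1 - θ 0)) :=
    ⟨⟨fun t => l t + (θ 1 - θ 0), by fun_prop⟩, by simp [hl0], rfl⟩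
  have key := windingHom_spec (((p.trans γ).trans p.symm).map F.continuous)
    ((Λ.symm.trans B).trans Λ' : Path _ _) (fun t => by
      change exp (((Λ.symm.trans B).trans Λ') t) = (F (((p.trans γ).trans p.symm) t)).1
      rw [Path.trans_apply, Path.trans_apply]
      split_ifs with h
      · rw [Path.trans_apply, Path.trans_apply]
        split_ifs with h'
        · change exp (l _) = _
          rw [hl]
          simp
        · exact hθ _
      · change exp (l _ + (θ 1 - θ 0)) = _
        rw [exp_add, hper, mul_one, hl])
  refine Eq.trans ?_ key
  change _ = ((Λ.symm.trans B).trans Λ') 1 - ((Λ.symm.trans B).trans Λ') 0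
  rw [Path.source, Path.target]
  ring

/-- A continuous logarithm of `w - c` along the circle `w = b + ζ exp(2πiNt)`. -/
theorem exists_log_circle_sub {b ζ : ℂ} (hζ : ζ ≠ 0) (N : ℕ) {c : ℂ} (hc : ‖c - b‖ ≠ ‖ζ‖) :
    ∃ θ : C(unitInterval, ℂ), (∀ t : unitInterval,
      exp (θ t) = b + ζ * exp (2 * Real.pi * I * N * (t : ℝ)) - c) ∧
      θ 1 - θ 0 = (if ‖c - b‖ < ‖ζ‖ then N else 0 : ℕ) * (2 * Real.pi * I) := by
  have hn : ∀ t : ℝ, ‖exp (2 * Real.pi * I * N * t)‖ = 1 := fun t => by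
    rw [show 2 * Real.pi * I * N * t = ((2 * Real.pi * N * t : ℝ) : ℂ) * I by push_cast; ring,
      norm_exp_ofReal_mul_I]
  have hn' : ∀ t : ℝ, ‖exp (-(2 * Real.pi * I * N * t))‖ = 1 := fun t => by
    rw [exp_neg, norm_inv, hn, inv_one]
  have hN : exp (2 * Real.pi * I * N) = 1 := by
    rw [mul_comm]; exact exp_nat_mul_two_pi_mul_I N
  have hN' : exp (-(2 * Real.pi * I * N)) = 1 := by rw [exp_neg, hN, inv_one]
  have hslit : ∀ z : ℂ, ‖z‖ < 1 → 1 - z ∈ slitPlane := fun z hz => by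
    rw [sub_eq_add_neg]
    exact mem_slitPlane_of_norm_lt_one (by rwa [norm_neg])
  rcases lt_or_gt_of_ne hc with h | h
  · have hlt : ∀ t : ℝ, ‖(c - b) / ζ * exp (-(2 * Real.pi * I * N * t))‖ < 1 := fun t => by
      rw [norm_mul, hn', mul_one, norm_div, div_lt_one (norm_pos_iff.2 hζ)]
      exact h
    refine ⟨⟨fun t => log ζ + 2 * Real.pi * I * N * (t : ℝ) +
      log (1 - (c - b) / ζ * exp (-(2 * Real.pi * I * N * (t : ℝ)))), ?_⟩, fun t => ?_, ?_⟩
    · refine (by fun_prop : Continuous _).add (Continuous.clog (by fun_prop) fun t => ?_)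
      exact hslit _ (hlt t)
    · change exp (log ζ + 2 * Real.pi * I * N * (t : ℝ) +
        log (1 - (c - b) / ζ * exp (-(2 * Real.pi * I * N * (t : ℝ))))) = _
      rw [exp_add, exp_add, exp_log hζ, exp_log (slitPlane_ne_zero (hslit _ (hlt t))), exp_neg]
      have := exp_ne_zero (2 * Real.pi * I * N * (t : ℝ))
      field_simp
      ring
    · simp [if_pos h, hN']
      ring
  · have hcb : c - b ≠ 0 := norm_pos_iff.1 ((norm_nonneg ζ).trans_lt h)
    have hlt : ∀ t : ℝ, ‖ζ / (c - b) * exp (2 * Real.pi * I * N * t)‖ < 1 := fun t => by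
      rw [norm_mul, hn, mul_one, norm_div, div_lt_one (norm_pos_iff.2 hcb)]
      exact h
    refine ⟨⟨fun t => log (-(c - b)) +
      log (1 - ζ / (c - b) * exp (2 * Real.pi * I * N * (t : ℝ))), ?_⟩, fun t => ?_, ?_⟩
    · refine continuous_const.add (Continuous.clog (by fun_prop) fun t => ?_)
      exact hslit _ (hlt t)
    · change exp (log (-(c - b)) +
        log (1 - ζ / (c - b) * exp (2 * Real.pi * I * N * (t : ℝ)))) = _
      rw [exp_add, exp_log (neg_ne_zero.2 hcb), exp_log (slitPlane_ne_zero (hslit _ (hlt t)))]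
      field_simp
      ring
    · simp [if_neg h.not_gt, hN]

/-- The argument principle for a product of linear factors on a circle. -/
theorem exists_log_circle_prod {b ζ : ℂ} (hζ : ζ ≠ 0) (N : ℕ) (s : Multiset ℂ)
    (hs : ∀ c ∈ s, ‖c - b‖ ≠ ‖ζ‖) :
    ∃ θ : C(unitInterval, ℂ), (∀ t : unitInterval, exp (θ t) =
      (s.map fun c => b + ζ * exp (2 * Real.pi * I * N * (t : ℝ)) - c).prod) ∧
      θ 1 - θ 0 = (N * s.countP (‖· - b‖ < ‖ζ‖) : ℕ) * (2 * Real.pi * I) := by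
  induction s using Multiset.induction_on with
  | empty => exact ⟨0, by simp, by simp⟩
  | cons c s ih =>
    obtain ⟨θ, h1, h2⟩ := ih fun a ha => hs a (Multiset.mem_cons_of_mem ha)
    obtain ⟨θ', h1', h2'⟩ := exists_log_circle_sub hζ N (hs c (Multiset.mem_cons_self c s))
    refine ⟨θ' + θ, fun t => ?_, ?_⟩
    · rw [ContinuousMap.add_apply, exp_add, h1, h1', Multiset.map_cons, Multiset.prod_cons]
    · rw [ContinuousMap.add_apply, ContinuousMap.add_apply, add_sub_add_comm, h2, h2',
        Multiset.countP_cons]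
      split_ifs <;> push_cast <;> ring

/-- The argument principle for polynomials on a circle. -/
theorem exists_log_circle_eval {b ζ : ℂ} (hζ : ζ ≠ 0) (N : ℕ) {P : Polynomial ℂ} (hP : P ≠ 0)
    (hs : ∀ c ∈ P.roots, ‖c - b‖ ≠ ‖ζ‖) :
    ∃ θ : C(unitInterval, ℂ), (∀ t : unitInterval,
      exp (θ t) = P.eval (b + ζ * exp (2 * Real.pi * I * N * (t : ℝ)))) ∧
      θ 1 - θ 0 = (N * P.roots.countP (‖· - b‖ < ‖ζ‖) : ℕ) * (2 * Real.pi * I) := by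
  obtain ⟨θ, h1, h2⟩ := exists_log_circle_prod hζ N P.roots hs
  refine ⟨.const _ (log P.leadingCoeff) + θ, fun t => ?_, by simpa using h2⟩
  have h3 := congrArg (Polynomial.eval (b + ζ * exp (2 * Real.pi * I * N * (t : ℝ))))
    (IsAlgClosed.splits P).eq_prod_roots
  rw [h3, ContinuousMap.add_apply, exp_add, h1, ContinuousMap.const_apply,
    exp_log (Polynomial.leadingCoeff_ne_zero.2 hP), Polynomial.eval_mul, Polynomial.eval_C,
    Polynomial.eval_multiset_prod]
  simp

end Winding

/-! ### At least two parallel lines -/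

section SeveralLines

/-- A cover by two open sets with simply connected intersection. -/
noncomputable def CutCover.ofSimplyConnected {X : Type u} [TopologicalSpace X] {x₀ : X}
    (V₁ V₂ : Set X) (h₁ : IsOpen V₁) (h₂ : IsOpen V₂) (h : ∀ x, x ∈ V₁ ∨ x ∈ V₂)
    [SimplyConnectedSpace ↥(V₁ ∩ V₂)] (w : ↥(V₁ ∩ V₂)) (q : Path.Homotopic.Quotient x₀ (w : X)) :
    CutCover x₀ where
  V₁ := V₁
  V₂ := V₂
  isOpen₁ := h₁
  isOpen₂ := h₂
  cover := h
  tail x hx := q.trans (.mk ((PathConnectedSpace.somePath w ⟨x, hx⟩).map continuous_subtype_val))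
  tail_trans x y hx hy γ hγ := by
    let γ' : Path (⟨x, hx⟩ : ↥(V₁ ∩ V₂)) ⟨y, hy⟩ :=
      ⟨⟨fun t => ⟨γ t, hγ t⟩, by fun_prop⟩, Subtype.ext γ.source, Subtype.ext γ.target⟩
    have e : Path.Homotopic.Quotient.mk γ = .mk (γ'.map continuous_subtype_val) := rfl
    rw [Path.Homotopic.Quotient.trans_assoc, e, ← Path.Homotopic.Quotient.mk_trans,
      ← Path.map_trans]
    congr 1
    exact Path.Homotopic.Quotient.eq.2 ((SimplyConnectedSpace.paths_homotopic _ _).map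
      ⟨_, continuous_subtype_val⟩)

/-- The degree is infinite if two loops on different sides of a cover have the same nonzero image
in `ℤ`. -/
theorem higherOrderDegree_eq_top {X : Type u} [TopologicalSpace X] {x₀ : X}
    (ψ : FundamentalGroup X x₀ →* Multiplicative ℤ) (n : ℕ) (𝒱 : CutCover x₀) {x : X}
    (hx : x ∈ 𝒱.V₁ ∩ 𝒱.V₂) (γ₁ γ₂ : Path x x) (h₁ : ∀ t, γ₁ t ∈ 𝒱.V₁) (h₂ : ∀ t, γ₂ t ∈ 𝒱.V₂)
    (h : ψ (loopOf ((𝒱.tail x hx).trans (.mk γ₁)) (𝒱.tail x hx)) =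
      ψ (loopOf ((𝒱.tail x hx).trans (.mk γ₂)) (𝒱.tail x hx)))
    (h0 : ψ (loopOf ((𝒱.tail x hx).trans (.mk γ₁)) (𝒱.tail x hx)) ≠ 1) :
    higherOrderDegree ψ n = ⊤ := by
  obtain ⟨Φ, hΦ⟩ := 𝒱.exists_functional_localH1 (coeffHom ψ n) hx γ₁ γ₂ h₁ h₂ rfl rfl
  exact toENat_rank_eq_top h h0 Φ hΦ

theorem exists_polynomial_line {σ : Type*} (f : MvPolynomial σ ℂ) (p v : σ → ℂ) :
    ∃ P : Polynomial ℂ, ∀ w, P.eval w = MvPolynomial.eval (p + w • v) f := by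
  refine ⟨MvPolynomial.aeval (fun j => Polynomial.C (p j) + Polynomial.C (v j) * Polynomial.X) f,
    fun w => ?_⟩
  induction f using MvPolynomial.induction_on with
  | C a => simp
  | add f g hf hg => simp [hf, hg]
  | mul_X f j hf =>
    rw [map_mul, map_mul, Polynomial.eval_mul, hf]
    simp [mul_comm w]

open Complex in
/-- The loop that runs `N` times along a circle in a line, and its linking number. -/
theorem exists_circle_loop {f : MvPolynomial (Fin 2) ℂ} {p v : Fin 2 → ℂ} {P : Polynomial ℂ}
    (hP : ∀ w, P.eval w = MvPolynomial.eval (p + w • v) f) (hp : MvPolynomial.eval p f ≠ 0)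
    {ζ : ℂ} (hζ : ζ ≠ 0) (N : ℕ) (hs : ∀ c ∈ P.roots, ‖c + ζ‖ ≠ ‖ζ‖) :
    ∃ γ : Path (⟨p, hp⟩ : CurveComplement f) ⟨p, hp⟩,
      (∀ t : unitInterval,
        (γ t).1 = p + (-ζ + ζ * exp (2 * Real.pi * I * N * (t : ℝ))) • v) ∧
      ∀ (u₀ : CurveComplement f) (q : Path.Homotopic.Quotient u₀ ⟨p, hp⟩),
        (linkingHom f u₀ (loopOf (q.trans (.mk γ)) q)).toAdd =
          (N * P.roots.countP (‖· + ζ‖ < ‖ζ‖) : ℕ) := by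
  have hP0 : P ≠ 0 := by
    rintro rfl
    exact hp (by simpa using (hP 0).symm)
  obtain ⟨θ, h1, h2⟩ := exists_log_circle_eval (b := -ζ) hζ N hP0 (by simpa using hs)
  have hN : exp (2 * Real.pi * I * N) = 1 := by
    rw [mul_comm]; exact exp_nat_mul_two_pi_mul_I N
  let γ : Path (⟨p, hp⟩ : CurveComplement f) ⟨p, hp⟩ :=
    { toFun := fun t => ⟨p + (-ζ + ζ * exp (2 * Real.pi * I * N * (t : ℝ))) • v, by
        rw [← hP, ← h1]; exact exp_ne_zero _⟩
      continuous_toFun := by fun_prop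
      source' := Subtype.ext (by simp)
      target' := Subtype.ext (by simp [hN]) }
  refine ⟨γ, fun t => rfl, fun u₀ q => ?_⟩
  have h3 := windingHom_map_loopOf (evalComplement f) q γ θ fun t => (h1 t).trans (hP _)
  rw [h2] at h3
  have h4 := mul_right_cancel₀ two_pi_I_ne_zero h3
  simp only [sub_neg_eq_add] at h4
  exact_mod_cast h4.symm

theorem eventually_norm_add_lt {c : ℂ} (hc : c.re < 0) : ∀ᶠ M : ℝ in atTop, ‖c + M‖ < M := by
  filter_upwards [eventually_gt_atTop 0, eventually_gt_atTop (Complex.normSq c / (-2 * c.re))]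
    with M h0 hM
  rw [div_lt_iff₀ (by linarith), Complex.normSq_apply] at hM
  refine lt_of_pow_lt_pow_left₀ 2 h0.le ?_
  rw [← Complex.normSq_eq_norm_sq, Complex.normSq_apply]
  simp only [Complex.add_re, Complex.ofReal_re, Complex.add_im, Complex.ofReal_im]
  nlinarith

theorem eventually_lt_norm_add {c : ℂ} (hc : 0 < c.re) : ∀ᶠ M : ℝ in atTop, M < ‖c + M‖ := by
  filter_upwards [eventually_gt_atTop 0] with M h0
  refine lt_of_lt_of_le ?_ (Complex.re_le_norm _)
  simpa using hc

theorem eventually_norm_add_ne {c : ℂ} (hc : c.re ≠ 0) : ∀ᶠ M : ℝ in atTop, ‖c + M‖ ≠ M := by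
  rcases lt_or_gt_of_ne hc with h | h
  · exact (eventually_norm_add_lt h).mono fun M h => h.ne
  · exact (eventually_lt_norm_add h).mono fun M h => h.ne'

/-- The degree is infinite if the curve consists of parallel lines `u - τ = c i`, none of them in the
real hyperplane `Re (u - τ) = 0`, that lie on both sides of this hyperplane. -/
theorem curveHigherOrderDegree_eq_top_of_re {ι : Type*} [Finite ι] {f : MvPolynomial (Fin 2) ℂ}
    (u₀ : CurveComplement f) (n : ℕ) (u : (Fin 2 → ℂ) →ₗ[ℂ] ℂ) (τ : ℂ) {v : Fin 2 → ℂ}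
    (hv : u v = 1) (c : ι → ℂ) (hc : ∀ z, MvPolynomial.eval z f = 0 ↔ ∃ i, u z - τ = c i)
    (hre : ∀ i, (c i).re ≠ 0) {i j : ι} (hi : (c i).re < 0) (hj : 0 < (c j).re) :
    curveHigherOrderDegree f u₀ n = ⊤ := by
  have hu : Continuous u := u.continuous_of_finiteDimensional
  -- The line through the base point in the direction of `v`, parametrized by `u - τ`.
  let l : ℂ → Fin 2 → ℂ := fun w => u₀.1 + (w - (u u₀.1 - τ)) • v
  have hl : ∀ w, u (l w) - τ = w := fun w => by
    simp only [l, map_add, map_smul, hv, smul_eq_mul]; ring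
  have hlf : ∀ w, MvPolynomial.eval (l w) f ≠ 0 ↔ w ∈ (Set.range c)ᶜ := fun w => by
    rw [Ne, hc, hl]; simp [eq_comm]
  have hlp : ∀ w, l w = l 0 + w • v := fun w => by
    simp only [l, sub_smul, zero_smul]; abel
  have h0 : (0 : ℂ) ∈ (Set.range c)ᶜ := by
    rintro ⟨k, hk⟩
    exact hre k (by rw [hk]; rfl)
  let w₀ : CurveComplement f := ⟨l 0, (hlf 0).2 h0⟩
  have hl₀ : l (u u₀.1 - τ) = u₀.1 := by simp [l]
  have hq : Nonempty (Path u₀ w₀) := by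
    have hconn := (Set.finite_range c).countable.isPathConnected_compl_of_one_lt_rank
      (by simp [Complex.rank_real_complex] : 1 < Module.rank ℝ ℂ)
    obtain ⟨γ, hγ⟩ := hconn.joinedIn (u u₀.1 - τ) ((hlf _).1 (by rw [hl₀]; exact u₀.2)) 0 h0
    exact ⟨⟨⟨fun t => ⟨l (γ t), (hlf _).2 (hγ t)⟩, by fun_prop⟩,
      Subtype.ext (by simp [hl₀]), Subtype.ext (by simp [w₀])⟩⟩
  obtain ⟨q⟩ := hq
  -- The strip `|Re (u - τ)| < ε` contains none of the lines.
  have : Nonempty ι := ⟨i⟩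
  obtain ⟨k, hk⟩ := Finite.exists_min fun i => |(c i).re|
  set ε := |(c k).re|
  have hε : 0 < ε := abs_pos.2 (hre k)
  have hstrip : ∀ z : Fin 2 → ℂ, (u z - τ).re < ε → -ε < (u z - τ).re →
      MvPolynomial.eval z f ≠ 0 := by
    intro z h1 h2 h3
    obtain ⟨i, hi⟩ := (hc z).1 h3
    rw [hi] at h1 h2
    exact (hk i).not_gt (abs_lt.2 ⟨h2, h1⟩)
  let V₁ : Set (CurveComplement f) := {x | (u x.1 - τ).re < ε}
  let V₂ : Set (CurveComplement f) := {x | -ε < (u x.1 - τ).re}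
  let S : Set (Fin 2 → ℂ) := {z | (u z - τ).re < ε ∧ -ε < (u z - τ).re}
  have hS : Convex ℝ S := by
    have := ((convex_halfSpace_re_lt (ε + τ.re)).inter (convex_halfSpace_re_gt (-ε + τ.re))
      ).linear_preimage (u.restrictScalars ℝ)
    refine (Set.ext fun z => ?_ : S = _) ▸ this
    change (u z - τ).re < ε ∧ -ε < (u z - τ).re ↔ (u z).re < ε + τ.re ∧ -ε + τ.re < (u z).re
    rw [Complex.sub_re]
    constructor <;> rintro ⟨h1, h2⟩ <;> constructor <;> linarith
  have h0V : w₀ ∈ V₁ ∩ V₂ := by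
    constructor
    · change (u (l 0) - τ).re < ε
      rw [hl]; exact hε
    · change -ε < (u (l 0) - τ).re
      rw [hl]; exact neg_lt_zero.2 hε
  have : ContractibleSpace S := hS.contractibleSpace ⟨w₀.1, h0V⟩
  let e : ↥(V₁ ∩ V₂) ≃ₜ S :=
    { toFun := fun x => ⟨x.1.1, x.2⟩
      invFun := fun z => ⟨⟨z.1, hstrip z.1 z.2.1 z.2.2⟩, z.2⟩
      left_inv := fun _ => rfl
      right_inv := fun _ => rfl
      continuous_toFun := by fun_prop
      continuous_invFun := by fun_prop }
  have : SimplyConnectedSpace ↥(V₁ ∩ V₂) := e.toHomotopyEquiv.simplyConnectedSpace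
  let 𝒱 : CutCover u₀ := .ofSimplyConnected V₁ V₂
    (isOpen_lt (by fun_prop) continuous_const) (isOpen_lt continuous_const (by fun_prop))
    (fun x => (lt_or_ge (u x.1 - τ).re ε).imp_right fun h =>
      lt_of_lt_of_le (neg_lt_self hε) h) ⟨w₀, h0V⟩ (.mk q)
  -- Circles through `0`, tangent to the imaginary axis, large enough to surround all the points
  -- on their side.
  obtain ⟨M, hM, hM₁, hM₂, hMi, hMj⟩ : ∃ M : ℝ, 0 < M ∧ (∀ i, ‖c i + M‖ ≠ M) ∧
      (∀ i, ‖-c i + M‖ ≠ M) ∧ ‖c i + M‖ < M ∧ ‖-c j + M‖ < M :=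
    ((eventually_gt_atTop 0).and <| (eventually_all.2 fun i => eventually_norm_add_ne (hre i)).and <|
      (eventually_all.2 fun i => eventually_norm_add_ne (c := -c i) (by simpa using hre i)).and <|
      (eventually_norm_add_lt hi).and (eventually_norm_add_lt (c := -c j) (by simpa using hj))).exists
  obtain ⟨P, hP⟩ := exists_polynomial_line f (l 0) v
  have hP0 : P ≠ 0 := by
    rintro rfl
    exact w₀.2 (by simpa using (hP 0).symm)
  have hroots : ∀ w, w ∈ P.roots ↔ ∃ i, w = c i := fun w => by
    rw [Polynomial.mem_roots hP0, Polynomial.IsRoot.def, hP, ← hlp, hc, hl]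
  have hMζ : (M : ℂ) ≠ 0 := Complex.ofReal_ne_zero.2 hM.ne'
  have hMn : ‖(M : ℂ)‖ = M := by rw [Complex.norm_real, Real.norm_of_nonneg hM.le]
  have hneg : ∀ w : ℂ, ‖w + -(M : ℂ)‖ = ‖-w + M‖ := fun w => by
    rw [← norm_neg]; congr 1; ring
  set N₁ := P.roots.countP (‖· + (M : ℂ)‖ < ‖(M : ℂ)‖)
  set N₂ := P.roots.countP (‖· + -(M : ℂ)‖ < ‖-(M : ℂ)‖)
  have hN₁ : 0 < N₁ := Multiset.countP_pos.2 ⟨c i, (hroots _).2 ⟨i, rfl⟩, by rwa [hMn]⟩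
  have hN₂ : 0 < N₂ := Multiset.countP_pos.2 ⟨c j, (hroots _).2 ⟨j, rfl⟩, by
    rwa [norm_neg, hMn, hneg]⟩
  obtain ⟨γ₁, hγ₁, hψ₁⟩ := exists_circle_loop hP w₀.2 hMζ N₂ (by
    intro w hw
    obtain ⟨i, rfl⟩ := (hroots w).1 hw
    rw [hMn]; exact hM₁ i)
  obtain ⟨γ₂, hγ₂, hψ₂⟩ := exists_circle_loop hP w₀.2 (neg_ne_zero.2 hMζ) N₁ (by
    intro w hw
    obtain ⟨i, rfl⟩ := (hroots w).1 hw
    rw [norm_neg, hMn, hneg]; exact hM₂ i)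
  have hexp : ∀ (N : ℕ) (t : ℝ), (Complex.exp (2 * Real.pi * Complex.I * N * t)).re ≤ 1 :=
    fun N t => by
      refine (Complex.re_le_norm _).trans_eq ?_
      rw [show 2 * Real.pi * Complex.I * N * t = ((2 * Real.pi * N * t : ℝ) : ℂ) * Complex.I by
        push_cast; ring, Complex.norm_exp_ofReal_mul_I]
  refine higherOrderDegree_eq_top (linkingHom f u₀) n 𝒱 h0V γ₁ γ₂ (fun t => ?_) (fun t => ?_) ?_ ?_
  · change (u (γ₁ t).1 - τ).re < ε
    rw [hγ₁, ← hlp, hl, Complex.add_re, Complex.neg_re, Complex.re_ofReal_mul, Complex.ofReal_re]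
    nlinarith [hexp N₂ t]
  · change -ε < (u (γ₂ t).1 - τ).re
    rw [hγ₂, ← hlp, hl, neg_mul, neg_neg, Complex.add_re, Complex.neg_re, Complex.re_ofReal_mul,
      Complex.ofReal_re]
    nlinarith [hexp N₁ t]
  · apply Multiplicative.toAdd.injective
    rw [hψ₁, hψ₂, mul_comm]
  · intro h
    have h1 := hψ₁ u₀ (𝒱.tail w₀ h0V)
    rw [h, toAdd_one] at h1
    have h2 : (0 : ℤ) = (N₂ * N₁ : ℕ) := h1
    exact (Nat.mul_pos hN₂ hN₁).ne (by exact_mod_cast h2)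

/-- The degree is infinite if the curve consists of at least two parallel lines. -/
theorem curveHigherOrderDegree_eq_top {ι : Type*} [Finite ι] {f : MvPolynomial (Fin 2) ℂ}
    (u₀ : CurveComplement f) (n : ℕ) (u : (Fin 2 → ℂ) →ₗ[ℂ] ℂ) {v : Fin 2 → ℂ}
    (hv : u v = 1) (c : ι → ℂ) (hc : ∀ z, MvPolynomial.eval z f = 0 ↔ ∃ i, u z = c i)
    {i j : ι} (hij : c i ≠ c j) : curveHigherOrderDegree f u₀ n = ⊤ := by
  -- Rotate so that `c i` is to the left of `c j`, and separate them by a vertical line.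
  let a : ℂ := (starRingEnd ℂ) (c j - c i)
  have ha : a ≠ 0 := (map_ne_zero _).2 (sub_ne_zero.2 hij.symm)
  have hre : (a * c i).re < (a * c j).re := by
    rw [← sub_pos, ← Complex.sub_re, ← mul_sub, ← Complex.normSq_eq_conj_mul_self,
      Complex.ofReal_re, Complex.normSq_pos, sub_ne_zero]
    exact hij.symm
  obtain ⟨τ, hτ, hτc⟩ := ((Set.Ioo_infinite hre).sdiff
    (Set.finite_range fun k => (a * c k).re)).nonempty
  refine curveHigherOrderDegree_eq_top_of_re u₀ n (a • u) τ (v := a⁻¹ • v) ?_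
    (fun k => a * c k - τ) (fun z => ?_) (fun k hk => hτc ⟨k, ?_⟩) (i := i) (j := j) ?_ ?_
  · simp [hv, ha]
  · rw [hc]
    simp [ha]
  · simpa [sub_eq_zero] using hk
  · simpa using hτ.1
  · simpa using hτ.2

end SeveralLines

/-! ### One line -/

section OneLine

theorem map_bijective_of_homotopyEquiv {X Y : Type*} [TopologicalSpace X] [TopologicalSpace Y]
    (e : ContinuousMap.HomotopyEquiv X Y) (x : X) :
    Function.Bijective (FundamentalGroup.map e.toFun x) :=
  (CategoryTheory.Functor.FullyFaithful.ofFullyFaithful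
    (FundamentalGroupoidFunctor.equivOfHomotopyEquiv e).functor).map_bijective _ _

theorem windingHom_bijective (z : {z : ℂ // z ≠ 0}) : Function.Bijective (windingHom z) :=
  (periodEquiv.symm.toMultiplicative.bijective.comp
    MulOpposite.opMulEquiv.symm.bijective).comp
    ⟨Complex.isAddQuotientCoveringMap_exp.fundamentalGroupToMulOpposite_injective _,
      Complex.isAddQuotientCoveringMap_exp.fundamentalGroupToMulOpposite_surjective _⟩

/-- The degree vanishes if the fundamental group is infinite cyclic. -/
theorem higherOrderDegree_eq_zero {X : Type u} [TopologicalSpace X] [PathConnectedSpace X] {x₀ : X}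
    (ψ ψ' : FundamentalGroup X x₀ →* Multiplicative ℤ) (h : Function.Bijective ψ') (n : ℕ) :
    higherOrderDegree ψ n = 0 := by
  obtain ⟨x, hx⟩ := h.2 (.ofAdd 1)
  have hgen : ∀ g, g ∈ Subgroup.zpowers x := fun g => by
    refine ⟨(ψ' g).toAdd, h.1 ?_⟩
    change ψ' (x ^ _) = _
    rw [map_zpow, hx, ← ofAdd_zsmul, smul_eq_mul, mul_one, ofAdd_toAdd]
  have hx1 : ψ' x ≠ 1 := by
    rw [hx]
    exact fun h => one_ne_zero (ofAdd_eq_one.1 h)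
  have : Subsingleton (LocalH1 (coeffHom ψ n)) :=
    subsingleton_localH1_of_cyclic (coeffHom ψ n) x hgen fun r hr =>
      coeffHom_sub_one_mul_eq_zero ψ n ψ' hx1 hr
  let _ : Module (skewK ψ n)ᵐᵒᵖ (LocalH1 (coeffHom ψ n)) :=
    Module.compHom _ (RingHom.op (skewKToRingR ψ n))
  change Cardinal.toENat (Module.rank (skewK ψ n)ᵐᵒᵖ (LocalH1 (coeffHom ψ n))) = 0
  rw [rank_subsingleton', map_zero]

/-- The degree vanishes if the curve is a line: its complement is homotopy equivalent to
`ℂ ∖ {0}`. -/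
theorem curveHigherOrderDegree_eq_zero {f : MvPolynomial (Fin 2) ℂ} (u₀ : CurveComplement f) (n : ℕ)
    (u : (Fin 2 → ℂ) →ₗ[ℂ] ℂ) {v : Fin 2 → ℂ} (hv : u v = 1) (c : ℂ)
    (hc : ∀ z, MvPolynomial.eval z f = 0 ↔ u z = c) : curveHigherOrderDegree f u₀ n = 0 := by
  have hu : Continuous u := u.continuous_of_finiteDimensional
  have hne : ∀ z, MvPolynomial.eval z f ≠ 0 ↔ u z - c ≠ 0 := fun z => by
    rw [Ne, hc, ← sub_eq_zero]
  let F : C(CurveComplement f, {z : ℂ // z ≠ 0}) :=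
    ⟨fun x => ⟨u x.1 - c, (hne _).1 x.2⟩, by fun_prop⟩
  let S : C({z : ℂ // z ≠ 0}, CurveComplement f) :=
    ⟨fun w => ⟨(c + w.1) • v, (hne _).2 (by simpa [hv] using w.2)⟩, by fun_prop⟩
  have hFS : F.comp S = .id _ := by
    ext w
    simp [F, S, hv]
  have hSF : (S.comp F).Homotopic (.id _) := by
    refine ⟨⟨⟨fun y => ⟨(1 - ((y.1 : ℝ) : ℂ)) • u y.2.1 • v + ((y.1 : ℝ) : ℂ) • y.2.1,
      (hne _).2 ?_⟩, by fun_prop⟩, fun x => ?_, fun x => ?_⟩⟩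
    · have : u ((1 - ((y.1 : ℝ) : ℂ)) • u y.2.1 • v + ((y.1 : ℝ) : ℂ) • y.2.1) = u y.2.1 := by
        simp only [map_add, map_smul, hv, smul_eq_mul]; ring
      rw [this]
      exact (hne _).1 y.2.2
    · apply Subtype.ext
      simp [F, S]
    · apply Subtype.ext
      simp
  let e : ContinuousMap.HomotopyEquiv (CurveComplement f) {z : ℂ // z ≠ 0} :=
    ⟨F, S, hSF, hFS ▸ .refl _⟩
  have : PathConnectedSpace (CurveComplement f) := by
    let Q : ℂ × (Fin 2 → ℂ) → CurveComplement f := fun y =>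
      ⟨y.2 + (c + Complex.exp y.1 - u y.2) • v,
        (hne _).2 (by simp [hv, Complex.exp_ne_zero])⟩
    have hQ : Function.Surjective Q := fun x =>
      ⟨(Complex.log (u x.1 - c), x.1), Subtype.ext (by
        simp [Q, Complex.exp_log ((hne _).1 x.2)])⟩
    exact hQ.pathConnectedSpace (by fun_prop)
  exact higherOrderDegree_eq_zero (linkingHom f u₀)
    ((windingHom (F u₀)).comp (FundamentalGroup.map F u₀))
    ((windingHom_bijective _).comp (map_bijective_of_homotopyEquiv e u₀)) n

end OneLine

/-! ### Equations of parallel lines -/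

/-- Parallel lines in the plane are the level sets of a linear form. -/
theorem exists_linearForm_of_parallel {ι : Type*} [Nonempty ι]
    {L : ι → AffineSubspace ℂ (Fin 2 → ℂ)} (hline : ∀ i, Module.finrank ℂ (L i).direction = 1)
    (hparallel : ∀ i j, (L i).Parallel (L j)) :
    ∃ (u : (Fin 2 → ℂ) →ₗ[ℂ] ℂ) (v : Fin 2 → ℂ) (c : ι → ℂ), u v = 1 ∧
      ∀ i z, z ∈ L i ↔ u z = c i := by
  obtain ⟨i₀⟩ := ‹Nonempty ι›
  have hlt : (L i₀).direction < ⊤ := by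
    rw [lt_top_iff_ne_top]
    intro h
    have := hline i₀
    rw [h, finrank_top, Module.finrank_fin_fun] at this
    omega
  obtain ⟨u, hu0, hu⟩ := Submodule.exists_le_ker_of_lt_top _ hlt
  obtain ⟨y, hy⟩ : ∃ y, u y ≠ 0 := by
    by_contra! h
    exact hu0 (LinearMap.ext h)
  have hker : (L i₀).direction = LinearMap.ker u := by
    refine Submodule.eq_of_le_of_finrank_le hu ?_
    have hrange : LinearMap.range u = ⊤ :=
      LinearMap.range_eq_top.2 (LinearMap.surjective hu0)
    have := u.finrank_range_add_finrank_ker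
    rw [hrange, finrank_top, Module.finrank_self, Module.finrank_fin_fun] at this
    rw [hline]
    omega
  have hp : ∀ i, ∃ p, p ∈ L i := fun i => by
    by_contra! h
    have hbot : L i = ⊥ := by
      rw [← AffineSubspace.coe_eq_bot_iff]
      exact Set.eq_empty_of_forall_notMem h
    have := hline i
    rw [hbot, AffineSubspace.direction_bot, finrank_bot] at this
    omega
  choose p hp using hp
  refine ⟨u, (u y)⁻¹ • y, fun i => u (p i), by simp [hy], fun i z => ?_⟩
  rw [← (L i).vsub_right_mem_direction_iff_mem (hp i), (hparallel i i₀).direction_eq, hker,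
    LinearMap.mem_ker, vsub_eq_sub, map_sub, sub_eq_zero]

end HigherDegree

theorem proposition3p2 (m : ℕ) (f : MvPolynomial (Fin 2) ℂ) (hf : Squarefree f)
    (L : Fin m → AffineSubspace ℂ (Fin 2 → ℂ))
    (hline : ∀ i, Module.finrank ℂ (L i).direction = 1)
    (hdistinct : Function.Injective L)
    (hparallel : ∀ i j, (L i).Parallel (L j))
    (hC : {z : Fin 2 → ℂ | MvPolynomial.eval z f = 0} = ⋃ i, (L i : Set (Fin 2 → ℂ)))
    (u₀ : HigherDegree.CurveComplement f) :
    (1 < m → ∀ n : ℕ, HigherDegree.curveHigherOrderDegree f u₀ n = ⊤) ∧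
    (m = 1 → ∀ n : ℕ, HigherDegree.curveHigherOrderDegree f u₀ n = 0) := by
  have hmem : ∀ z, MvPolynomial.eval z f = 0 ↔ ∃ i, z ∈ L i := fun z => by
    have h : z ∈ {z : Fin 2 → ℂ | MvPolynomial.eval z f = 0} ↔ z ∈ ⋃ i, (L i : Set (Fin 2 → ℂ)) := by
      rw [hC]
    rw [Set.mem_iUnion] at h
    exact h
  constructor
  · intro hm n
    have : Nonempty (Fin m) := ⟨⟨0, by omega⟩⟩
    obtain ⟨u, v, c, hv, hc⟩ := HigherDegree.exists_linearForm_of_parallel hline hparallel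
    have hcinj : Function.Injective c := fun i j h =>
      hdistinct (SetLike.ext fun z => by rw [hc, hc, h])
    refine HigherDegree.curveHigherOrderDegree_eq_top u₀ n u hv c (fun z => ?_)
      (i := ⟨0, by omega⟩) (j := ⟨1, hm⟩) (hcinj.ne (by simp))
    simp only [hmem, hc]
  · rintro rfl n
    obtain ⟨u, v, c, hv, hc⟩ := HigherDegree.exists_linearForm_of_parallel hline hparallel
    refine HigherDegree.curveHigherOrderDegree_eq_zero u₀ n u hv (c 0) fun z => ?_
    rw [hmem, Fin.exists_fin_one, hc]
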